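/- **Languages.** Let $\mathcal L_0$ be the propositional language over variables $p_0,p_1,\dots$ with $\bot,\land,\lor,\to$ (and $\neg\varphi:=\varphi\to\bot$; an empty conjunction is $\bot\to\bot$), and let $\mathcal L_\Box$ be its extension by a modality $\Box$. Justification terms are $t::=x_i\mid c_i\mid [t+t]\mid[t\cdot t]\mid\,!t$ $(i\in\mathbb N)$, with justification variables $x_i$ and justification constants $c_i$, and $\mathcal L_J$ extends $\mathcal L_0$ by formulas $t:\varphi$ for all terms $t$. **Propositional logics.** $\mathbf{IPC}$ is intuitionistic propositional logic. For sets of formulas, $\Gamma+\Delta$ is the closure of $\Gamma\cup\Delta$ under modus ponens, and a scheme stands for the set of all its instances. Put $\mathbf G:=\mathbf{IPC}+\{(\varphi\to\psi)\lor(\psi\to\varphi)\}$, for $n\ge2$ $$\mathbf{G_n}:=\mathbf G+\Big\{\bigvee_{i=0}^{n-1}\Big(\bigwedge_{j<i}\varphi_j\to\varphi_i\Big)\Big\},\qquad \mathbf{KC}:=\mathbf{IPC}+\{\neg\neg\varphi\lor\neg\varphi\}.$$ **Justification logics.** For an intermediate logic $\mathbf L$ let $\overline{\mathbf L}\subseteq\mathcal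 L_J$ be the set of all substitution instances of members of $\mathbf L$ by $\mathcal L_J$-formulas. Consider the schemes $(J)$ $t:(\varphi\to\psi)\to(s:\varphi\to[t\cdot s]:\psi)$; $(+)$ $t:\varphi\to[t+s]:\varphi$ and $t:\varphi\to[s+t]:\varphi$; $(F)$ $t:\varphi\to\varphi$; $(I)$ $t:\varphi\to\,!t:t:\varphi$. The axioms of $\mathbf{LJ}$ are $\overline{\mathbf L}\cup(J)\cup(+)$; those of $\mathbf{LJT}$, $\mathbf{LJ4}$, $\mathbf{LJT4}$ contain in addition $(F)$, $(I)$, and both $(F)$ and $(I)$, respectively. If $A$ is the set of axioms of one of these logics, its total constant specification consists of all $c_{i_m}:\dots:c_{i_1}:\alpha$ with $m\ge1$ and $\alpha\in A$; the logic proves $\psi$ if for finitely many members $\gamma_1,\dots,\gamma_k$ $(k\ge0)$ of it, $(\gamma_1\land\dots\land\gamma_k)\to\psi$ is derivable from $A$ by modus ponens. **Modal logics.** For $\Gamma,\Delta\subseteq\mathcal L_\Box$ let $\Gamma\oplus\Delta$ be the closure of $\Gamma\cup\Delta$ under modus ponens, substitution in $\mathcal L_\Box$ and necessitation. Put $\mathbf{LK}:=\mathbf{IPCK}\oplus\mathbf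 L$ with $\mathbf{IPCK}:=\mathbf{IPC}\oplus\{\Box(\varphi\to\psi)\to(\Box\varphi\to\Box\psi)\}$, $\mathbf{LT}:=\mathbf{LK}\oplus\{\Box\varphi\to\varphi\}$, $\mathbf{LK4}:=\mathbf{LK}\oplus\{\Box\varphi\to\Box\Box\varphi\}$, $\mathbf{LS4}:=\mathbf{LT}\oplus\{\Box\varphi\to\Box\Box\varphi\}$. **Realization.** A unique annotation $\varphi'$ of $\varphi\in\mathcal L_\Box$ arises by indexing the occurrences of $\Box$ in $\varphi$ with pairwise different natural numbers. Sets $\mathrm r_T(\varphi'),\mathrm r_F(\varphi')\subseteq\mathcal L_J$ are defined by recursion, for $S\in\{T,F\}$ with opposite $\bar S$: $\mathrm r_S(\varphi')=\{\varphi'\}$ if $\varphi'$ is $\bot$ or a variable; $\mathrm r_S(\varphi'\circ\psi')=\{\alpha\circ\beta\mid\alpha\in\mathrm r_S(\varphi'),\beta\in\mathrm r_S(\psi')\}$ for $\circ\in\{\land,\lor\}$; $\mathrm r_S(\varphi'\to\psi')=\{\alpha\to\beta\mid\alpha\in\mathrm r_{\bar S}(\varphi'),\beta\in\mathrm r_S(\psi')\}$;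 $\mathrm r_T(\Box_n\varphi')=\{x_n:\alpha\mid\alpha\in\mathrm r_T(\varphi')\}$; $\mathrm r_F(\Box_n\varphi')=\{t:\alpha\mid\alpha\in\mathrm r_F(\varphi'),\ t\text{ a term}\}$. A realization of $\varphi$ is an element of $\mathrm r_F(\varphi')$ for a unique annotation $\varphi'$ of $\varphi$. A justification logic *realizes* a modal logic if every theorem $\varphi$ of the modal logic has a realization that is provable in the justification logic, and moreover, for every unique annotation $\varphi'$ of $\varphi$, such a realization exists in $\mathrm r_F(\varphi')$. **Theorem.** 1. For every $n\ge2$, the logics $\mathbf{G_nJ},\mathbf{G_nJT},\mathbf{G_nJ4},\mathbf{G_nJT4}$ realize $\mathbf{G_nK},\mathbf{G_nT},\mathbf{G_nK4},\mathbf{G_nS4}$, respectively. 2. The logics $\mathbf{KCJ},\mathbf{KCJT},\mathbf{KCJ4},\mathbf{KCJT4}$ realize $\mathbf{KCK},\mathbf{KCT},\mathbf{KCK4},\mathbf{KCS4}$, respectively. -/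

import Mathlib

namespace InterJust

/-- Formulas over the variables `p_0, p_1, …` built from `⊥, ∧, ∨, →` and one unary modality
for every element of `M`. -/
inductive Form (M : Type) : Type where
  | bot : Form M
  | var : ℕ → Form M
  | and : Form M → Form M → Form M
  | or : Form M → Form M → Form M
  | imp : Form M → Form M → Form M
  | box : M → Form M → Form M

/-- Justification terms: variables `x_i`, constants `c_i`, sum, application, proof checker. -/
inductive JTerm : Type where
  | var : ℕ → JTerm
  | const : ℕ → JTerm
  | sum : JTerm → JTerm → JTerm
  | app : JTerm → JTerm → JTerm
  | bang : JTerm → JTerm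

/-- The propositional language. -/
abbrev PropForm : Type := Form Empty

/-- The justification language; `t : φ` is `Form.box t φ`. -/
abbrev JForm : Type := Form JTerm

/-- The modal language; `□ φ` is `Form.box () φ`. -/
abbrev ModalForm : Type := Form Unit

/-- The annotated modal language; `□_n φ` is `Form.box n φ`. -/
abbrev AnnForm : Type := Form ℕ

namespace Form

variable {M N : Type}

/-- Negation. -/
def neg (φ : Form M) : Form M := φ.imp bot

/-- Substitution of formulas for propositional variables. -/
def subst (σ : ℕ → Form M) : Form M → Form M
  | bot => bot
  | var p => σ p
  | and φ ψ => and (subst σ φ) (subst σ ψ)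
  | or φ ψ => or (subst σ φ) (subst σ ψ)
  | imp φ ψ => imp (subst σ φ) (subst σ ψ)
  | box m φ => box m (subst σ φ)

/-- Change of modalities along `f`. -/
def map (f : M → N) : Form M → Form N
  | bot => bot
  | var p => var p
  | and φ ψ => and (map f φ) (map f ψ)
  | or φ ψ => or (map f φ) (map f ψ)
  | imp φ ψ => imp (map f φ) (map f ψ)
  | box m φ => box (f m) (map f φ)

/-- The inclusion of the propositional language in the language with modalities `M`. -/
def ofProp (M : Type) (φ : PropForm) : Form M := φ.map Empty.elim

/-- Finite conjunctions; the empty one is `⊥ → ⊥`. -/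
def bigAnd : List (Form M) → Form M
  | [] => neg bot
  | [φ] => φ
  | φ :: ψ :: l => and φ (bigAnd (ψ :: l))

/-- Finite disjunctions; the empty one is `⊥`. -/
def bigOr : List (Form M) → Form M
  | [] => bot
  | [φ] => φ
  | φ :: ψ :: l => or φ (bigOr (ψ :: l))

/-- The list of all occurrences of modalities in a formula. -/
def modalities : Form M → List M
  | bot => []
  | var _ => []
  | and φ ψ => modalities φ ++ modalities ψ
  | or φ ψ => modalities φ ++ modalities ψ
  | imp φ ψ => modalities φ ++ modalities ψ
  | box m φ => m :: modalities φ

end Form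

open Form

/-! ### Intermediate propositional logics -/

/-- The instances of the axiom schemes of intuitionistic propositional logic. -/
inductive IntAxiom : PropForm → Prop where
  | a1 (φ ψ : PropForm) : IntAxiom (φ.imp (ψ.imp φ))
  | a2 (φ χ ψ : PropForm) :
      IntAxiom ((φ.imp (χ.imp ψ)).imp ((φ.imp χ).imp (φ.imp ψ)))
  | a3 (φ ψ : PropForm) : IntAxiom ((φ.and ψ).imp φ)
  | a4 (φ ψ : PropForm) : IntAxiom ((φ.and ψ).imp ψ)
  | a5 (φ ψ : PropForm) : IntAxiom (φ.imp (ψ.imp (φ.and ψ)))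
  | a6 (φ ψ : PropForm) : IntAxiom (φ.imp (φ.or ψ))
  | a7 (φ ψ : PropForm) : IntAxiom (ψ.imp (φ.or ψ))
  | a8 (φ ψ χ : PropForm) :
      IntAxiom ((φ.imp ψ).imp ((χ.imp ψ).imp ((φ.or χ).imp ψ)))
  | a9 (φ : PropForm) : IntAxiom (bot.imp φ)

/-- The closure of a set of formulas under modus ponens. -/
inductive MPClosure {M : Type} (Γ : Set (Form M)) : Form M → Prop where
  | base {φ : Form M} : φ ∈ Γ → MPClosure Γ φ
  | mp {φ ψ : Form M} : MPClosure Γ (φ.imp ψ) → MPClosure Γ φ → MPClosure Γ ψ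

/-- `Γ + Δ`: the smallest set that contains `Γ ∪ Δ` and is closed under modus ponens. -/
def plus {M : Type} (Γ Δ : Set (Form M)) : Set (Form M) := {φ | MPClosure (Γ ∪ Δ) φ}

/-- Intuitionistic propositional logic. -/
def IPC : Set PropForm := {φ | MPClosure {ψ | IntAxiom ψ} φ}

/-- The scheme `(φ → ψ) ∨ (ψ → φ)`. -/
def LIN : Set PropForm := {χ | ∃ φ ψ : PropForm, χ = (φ.imp ψ).or (ψ.imp φ)}

/-- The scheme `⋁_{i=0}^n (⋀_{j<i} φ_j → φ_i)`. -/
def BC (n : ℕ) : Set PropForm :=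
  {χ | ∃ f : ℕ → PropForm, χ = bigOr ((List.range (n + 1)).map fun i =>
    (bigAnd ((List.range i).map f)).imp (f i))}

/-- The scheme `¬¬φ ∨ ¬φ`. -/
def WLEM : Set PropForm := {χ | ∃ φ : PropForm, χ = φ.neg.neg.or φ.neg}

/-- Gödel–Dummett logic. -/
def G : Set PropForm := plus IPC LIN

/-- The `n`-valued Gödel logic, for `n ≥ 2`. -/
def Gn (n : ℕ) : Set PropForm := plus G (BC (n - 1))

/-- Jankov's logic. -/
def KC : Set PropForm := plus IPC WLEM

/-! ### Justification logics based on a propositional logic -/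

/-- The closure of a propositional logic under substitutions in the justification language. -/
def substClosure (L : Set PropForm) : Set JForm :=
  {χ | ∃ (φ : PropForm) (σ : ℕ → JForm), φ ∈ L ∧ χ = (ofProp JTerm φ).subst σ}

/-- The scheme `t:(φ → ψ) → (s:φ → [t·s]:ψ)`. -/
def AxJ : Set JForm :=
  {χ | ∃ (t s : JTerm) (φ ψ : JForm),
    χ = (box t (φ.imp ψ)).imp ((box s φ).imp (box (t.app s) ψ))}

/-- The schemes `t:φ → [t+s]:φ` and `t:φ → [s+t]:φ`. -/
def AxSum : Set JForm :=
  {χ | ∃ (t s : JTerm) (φ : JForm),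
    χ = (box t φ).imp (box (t.sum s) φ) ∨ χ = (box t φ).imp (box (s.sum t) φ)}

/-- The scheme `t:φ → φ`. -/
def AxF : Set JForm := {χ | ∃ (t : JTerm) (φ : JForm), χ = (box t φ).imp φ}

/-- The scheme `t:φ → !t:t:φ`. -/
def AxI : Set JForm :=
  {χ | ∃ (t : JTerm) (φ : JForm), χ = (box t φ).imp (box t.bang (box t φ))}

/-- The total constant specification over a set `A` of axioms: all formulas
`c_{i_n} : … : c_{i_1} : φ` with `n ≥ 1` and `φ ∈ A`. -/
inductive TCS (A : Set JForm) : JForm → Prop where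
  | base (i : ℕ) {φ : JForm} : φ ∈ A → TCS A (box (JTerm.const i) φ)
  | step (i : ℕ) {φ : JForm} : TCS A φ → TCS A (box (JTerm.const i) φ)

/-- The theorems of the justification logic with axioms `A` and total constant specification:
`φ` is a theorem if `⋀ γ_i → φ` is derivable from `A` by modus ponens, for finitely many members
`γ_i` of the total constant specification. -/
def justLogic (A : Set JForm) : Set JForm :=
  {φ | ∃ l : List JForm, (∀ γ ∈ l, TCS A γ) ∧ MPClosure A ((bigAnd l).imp φ)}

/-- The logic `LJ` over the propositional logic `L`. -/
def justJ (L : Set PropForm) : Set JForm := justLogic (substClosure L ∪ AxJ ∪ AxSum)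

/-- The logic `LJT` over the propositional logic `L`. -/
def justJT (L : Set PropForm) : Set JForm := justLogic (substClosure L ∪ AxJ ∪ AxSum ∪ AxF)

/-- The logic `LJ4` over the propositional logic `L`. -/
def justJ4 (L : Set PropForm) : Set JForm := justLogic (substClosure L ∪ AxJ ∪ AxSum ∪ AxI)

/-- The logic `LJT4` over the propositional logic `L`. -/
def justJT4 (L : Set PropForm) : Set JForm :=
  justLogic (substClosure L ∪ AxJ ∪ AxSum ∪ AxF ∪ AxI)

/-! ### Modal logics based on a propositional logic -/

/-- The closure of a set of modal formulas under modus ponens, substitution and necessitation. -/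
inductive NormalClosure (Γ : Set ModalForm) : ModalForm → Prop where
  | base {φ : ModalForm} : φ ∈ Γ → NormalClosure Γ φ
  | mp {φ ψ : ModalForm} :
      NormalClosure Γ (φ.imp ψ) → NormalClosure Γ φ → NormalClosure Γ ψ
  | subst (σ : ℕ → ModalForm) {φ : ModalForm} :
      NormalClosure Γ φ → NormalClosure Γ (φ.subst σ)
  | nec {φ : ModalForm} : NormalClosure Γ φ → NormalClosure Γ (box () φ)

/-- `Γ ⊕ Δ`: the normal closure of `Γ ∪ Δ`. -/
def oplus (Γ Δ : Set ModalForm) : Set ModalForm := {φ | NormalClosure (Γ ∪ Δ) φ}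

/-- The scheme `□(φ → ψ) → (□φ → □ψ)`. -/
def AxK : Set ModalForm :=
  {χ | ∃ φ ψ : ModalForm, χ = (box () (φ.imp ψ)).imp ((box () φ).imp (box () ψ))}

/-- The scheme `□φ → φ`. -/
def AxT : Set ModalForm := {χ | ∃ φ : ModalForm, χ = (box () φ).imp φ}

/-- The scheme `□φ → □□φ`. -/
def Ax4 : Set ModalForm := {χ | ∃ φ : ModalForm, χ = (box () φ).imp (box () (box () φ))}

/-- The smallest intermediate modal logic. -/
def IPCK : Set ModalForm := oplus (ofProp Unit '' IPC) AxK

/-- The logic `LK` over the propositional logic `L`. -/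
def modalK (L : Set PropForm) : Set ModalForm := oplus IPCK (ofProp Unit '' L)

/-- The logic `LT` over the propositional logic `L`. -/
def modalT (L : Set PropForm) : Set ModalForm := oplus (modalK L) AxT

/-- The logic `LK4` over the propositional logic `L`. -/
def modalK4 (L : Set PropForm) : Set ModalForm := oplus (modalK L) Ax4

/-- The logic `LS4` over the propositional logic `L`. -/
def modalS4 (L : Set PropForm) : Set ModalForm := oplus (oplus (modalK L) AxT) Ax4

/-! ### Realizations -/

/-- `φ'` is a unique annotation of `φ`: dropping the indices of the boxes gives `φ`, and no index
occurs more than once. -/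
def IsUniqueAnnotation (φ : ModalForm) (φ' : AnnForm) : Prop :=
  φ'.map (fun _ => ()) = φ ∧ φ'.modalities.Nodup

/-- The two polarities. -/
inductive Pol : Type where
  | T : Pol
  | F : Pol

/-- The opposite polarity. -/
def Pol.flip : Pol → Pol
  | T => F
  | F => T

/-- The justification formulas that realize an annotated formula at a given polarity: at polarity
`T` the box `□_n` becomes the justification variable `x_n`, at polarity `F` any term. -/
def realizations : Pol → AnnForm → Set JForm
  | _, .bot => {.bot}
  | _, .var p => {.var p}
  | s, .and φ ψ => {χ | ∃ α ∈ realizations s φ, ∃ β ∈ realizations s ψ, χ = α.and β}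
  | s, .or φ ψ => {χ | ∃ α ∈ realizations s φ, ∃ β ∈ realizations s ψ, χ = α.or β}
  | s, .imp φ ψ =>
      {χ | ∃ α ∈ realizations s.flip φ, ∃ β ∈ realizations s ψ, χ = α.imp β}
  | Pol.T, .box n φ => {χ | ∃ α ∈ realizations Pol.T φ, χ = box (JTerm.var n) α}
  | Pol.F, .box _ φ => {χ | ∃ α ∈ realizations Pol.F φ, ∃ t : JTerm, χ = box t α}

/-- `ψ` is a realization of the modal formula `φ`. -/
def IsRealization (φ : ModalForm) (ψ : JForm) : Prop :=
  ∃ φ' : AnnForm, IsUniqueAnnotation φ φ' ∧ ψ ∈ realizations Pol.F φ'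

/-- The justification logic `J` realizes the modal logic `S`: every theorem of `S` has a
realization that is a theorem of `J`, and one can be found for any choice of a unique annotation. -/
def Realizes (J : Set JForm) (S : Set ModalForm) : Prop :=
  ∀ φ ∈ S, (∃ ψ ∈ J, IsRealization φ ψ) ∧
    ∀ φ' : AnnForm, IsUniqueAnnotation φ φ' → ∃ ψ ∈ J, ψ ∈ realizations Pol.F φ'

end InterJust

open InterJust

open InterJust

namespace InterJust

open Form

/-! ### Intuitionistic reasoning in Hilbert systems -/

/-! The argument is semantic, with no sequent calculus. For each justification logic take the
canonical frame whose worlds are the prime theories containing its theorems, ordered by inclusion,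
with `w.Rel v` when every formula justified by some term in `w` lies in `v`. The propositional
schemes involved are canonical: linearity, bounded chains and weak excluded middle force the
matching order properties (`World.linear`, `World.no_chain`, `World.directed`), while (F) and (I)
make `World.Rel` reflexive and transitive. Hence every modal theorem is valid in this frame.

Validity is turned into provability by `truth_lemma`, which compares forcing of a modal formula with
membership of its quasi-realizations. These may join several candidates for a subformula, by `∧` at
polarity `T` and by `∨` at `F`: the deduction theorem needs a set of assumptions closed under `∧`,
and prime extension needs a set to avoid that is closed under `∨`. If no quasi-realization were
provable, some world would avoid them all, against validity (`exists_quasi_mem`).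

Finally `JustSystem.convertible` merges finitely many quasi-realizations into one genuine
realization, by induction on the formula. At a negative box the variable `x_n` is replaced by `u ·
x_n`, with `u` internalizing the implications found below it; at a positive box the terms are
collected by sums. Uniqueness of the indices makes the substitutions from different subformulas
compatible (`LivesOn.merge`). -/

/-- The set `B` contains all instances of the schemes of intuitionistic propositional logic. -/
structure IntSystem {M : Type} (B : Set (Form M)) : Prop where
  k : ∀ a b : Form M, a.imp (b.imp a) ∈ B
  s : ∀ a b c : Form M, (a.imp (b.imp c)).imp ((a.imp b).imp (a.imp c)) ∈ B
  andLeft : ∀ a b : Form M, (a.and b).imp a ∈ B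
  andRight : ∀ a b : Form M, (a.and b).imp b ∈ B
  andIntro : ∀ a b : Form M, a.imp (b.imp (a.and b)) ∈ B
  orLeft : ∀ a b : Form M, a.imp (a.or b) ∈ B
  orRight : ∀ a b : Form M, b.imp (a.or b) ∈ B
  orElim : ∀ a b c : Form M, (a.imp b).imp ((c.imp b).imp ((a.or c).imp b)) ∈ B
  exFalso : ∀ a : Form M, bot.imp a ∈ B

/-- A set of formulas that contains the intuitionistic axioms and is closed under modus ponens. -/
structure IntTheory {M : Type} (T : Set (Form M)) : Prop extends IntSystem T where
  mp : ∀ {a b : Form M}, a.imp b ∈ T → a ∈ T → b ∈ T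

section Hilbert

variable {M : Type} {B C : Set (Form M)} {a b c d : Form M}

theorem IntSystem.mono (h : IntSystem B) (hBC : B ⊆ C) : IntSystem C :=
  ⟨fun _ _ => hBC (h.k _ _), fun _ _ _ => hBC (h.s _ _ _), fun _ _ => hBC (h.andLeft _ _),
    fun _ _ => hBC (h.andRight _ _), fun _ _ => hBC (h.andIntro _ _),
    fun _ _ => hBC (h.orLeft _ _), fun _ _ => hBC (h.orRight _ _),
    fun _ _ _ => hBC (h.orElim _ _ _), fun _ => hBC (h.exFalso _)⟩

theorem subset_mpClosure (B : Set (Form M)) : B ⊆ {φ | MPClosure B φ} := fun _ => MPClosure.base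

theorem IntSystem.theory (h : IntSystem B) : IntTheory {φ | MPClosure B φ} :=
  ⟨h.mono (subset_mpClosure B), MPClosure.mp⟩

namespace IntTheory

variable {T : Set (Form M)} (h : IntTheory T)
include h

theorem weaken (ha : a ∈ T) (b : Form M) : b.imp a ∈ T := h.mp (h.k a b) ha

theorem app (hab : d.imp (a.imp b) ∈ T) (ha : d.imp a ∈ T) : d.imp b ∈ T :=
  h.mp (h.mp (h.s _ _ _) hab) ha

theorem refl (a : Form M) : a.imp a ∈ T := h.app (h.k a (a.imp a)) (h.k a a)

theorem trans (hab : a.imp b ∈ T) (hbc : b.imp c ∈ T) : a.imp c ∈ T := h.app (h.weaken hbc a) hab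

theorem and_mem : a.and b ∈ T ↔ a ∈ T ∧ b ∈ T :=
  ⟨fun hab => ⟨h.mp (h.andLeft _ _) hab, h.mp (h.andRight _ _) hab⟩,
    fun hab => h.mp (h.mp (h.andIntro _ _) hab.1) hab.2⟩

theorem or_elim (hac : a.imp c ∈ T) (hbc : b.imp c ∈ T) : (a.or b).imp c ∈ T :=
  h.mp (h.mp (h.orElim _ _ _) hac) hbc

theorem and_intro (hca : c.imp a ∈ T) (hcb : c.imp b ∈ T) : c.imp (a.and b) ∈ T :=
  h.app (h.trans hca (h.andIntro _ _)) hcb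

theorem and_mono (hab : a.imp b ∈ T) (hcd : c.imp d ∈ T) : (a.and c).imp (b.and d) ∈ T :=
  h.and_intro (h.trans (h.andLeft _ _) hab) (h.trans (h.andRight _ _) hcd)

theorem or_mono (hab : a.imp b ∈ T) (hcd : c.imp d ∈ T) : (a.or c).imp (b.or d) ∈ T :=
  h.or_elim (h.trans hab (h.orLeft _ _)) (h.trans hcd (h.orRight _ _))

theorem imp_mono (hba : b.imp a ∈ T) (hcd : c.imp d ∈ T) : (a.imp c).imp (b.imp d) ∈ T :=
  h.trans (h.app (h.trans (h.k (a.imp c) b) (h.s _ _ _)) (h.weaken hba _))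
    (h.mp (h.s _ _ _) (h.weaken hcd b))

theorem bigAnd_imp {l : List (Form M)} (ha : a ∈ l) : (bigAnd l).imp a ∈ T := by
  induction l with
  | nil => simp at ha
  | cons b l ih =>
    cases l with
    | nil => rw [List.mem_singleton.1 ha]; exact h.refl _
    | cons c l =>
      rcases List.mem_cons.1 ha with rfl | ha
      · exact h.andLeft _ _
      · exact h.trans (h.andRight _ _) (ih ha)

theorem imp_bigAnd {l : List (Form M)} (hl : ∀ b ∈ l, a.imp b ∈ T) : a.imp (bigAnd l) ∈ T := by
  induction l with
  | nil => exact h.weaken (h.refl _) _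
  | cons b l ih =>
    cases l with
    | nil => exact hl b (by simp)
    | cons c l =>
      exact h.and_intro (hl _ (by simp)) (ih fun x hx => hl _ (List.mem_cons_of_mem _ hx))

theorem bigAnd_mem {l : List (Form M)} (hl : ∀ b ∈ l, b ∈ T) : bigAnd l ∈ T :=
  h.mp (h.imp_bigAnd fun b hb => h.weaken (hl b hb) ((bot : Form M).imp bot)) (h.refl _)

theorem mpClosure_subset (hB : B ⊆ T) (ha : MPClosure B a) : a ∈ T := by
  induction ha with
  | base h => exact hB h
  | mp _ _ ih₁ ih₂ => exact h.mp ih₁ ih₂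

/-- Deduction theorem for a set of assumptions closed under conjunction. -/
theorem deduction {X : Set (Form M)} (hne : X.Nonempty)
    (hX : ∀ x ∈ X, ∀ y ∈ X, x.and y ∈ X) (ha : MPClosure (T ∪ X) a) : ∃ x ∈ X, x.imp a ∈ T := by
  induction ha with
  | base ha =>
    rcases ha with ha | ha
    · exact ⟨_, hne.some_mem, h.weaken ha _⟩
    · exact ⟨_, ha, h.refl _⟩
  | mp _ _ ih₁ ih₂ =>
    obtain ⟨x, hx, hxab⟩ := ih₁
    obtain ⟨y, hy, hya⟩ := ih₂
    exact ⟨_, hX x hx y hy, h.app (h.trans (h.andLeft _ _) hxab) (h.trans (h.andRight _ _) hya)⟩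

theorem deduction_insert (ha : MPClosure (insert b T) a) : b.imp a ∈ T := by
  induction ha with
  | base ha =>
    rcases ha with rfl | ha
    · exact h.refl _
    · exact h.weaken ha _
  | mp _ _ ih₁ ih₂ => exact h.app ih₁ ih₂

end IntTheory

/-! ### Prime theories and the prime extension lemma. -/

/-- A prime theory: a consistent theory with the disjunction property. -/
structure PrimeTheory (T : Set (Form M)) : Prop extends IntTheory T where
  consistent : bot ∉ T
  prime : ∀ {a b : Form M}, a.or b ∈ T → a ∈ T ∨ b ∈ T

/-- A theory disjoint from a set closed under disjunction extends to a prime theory disjoint from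
that set. -/
theorem IntTheory.exists_prime {T S : Set (Form M)} (h : IntTheory T) (hne : S.Nonempty)
    (hS : ∀ x ∈ S, ∀ y ∈ S, x.or y ∈ S) (hTS : ∀ x ∈ T, x ∉ S) :
    ∃ P, T ⊆ P ∧ PrimeTheory P ∧ ∀ x ∈ P, x ∉ S := by
  obtain ⟨P, hTP, hP⟩ := zorn_subset_nonempty
    {U : Set (Form M) | IntTheory U ∧ ∀ x ∈ U, x ∉ S} (by
      intro c hc hchain hcne
      obtain ⟨U₀, hU₀⟩ := hcne
      refine ⟨⋃₀ c, ⟨⟨(hc hU₀).1.toIntSystem.mono (Set.subset_sUnion_of_mem hU₀), ?_⟩, ?_⟩,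
        fun U hU => Set.subset_sUnion_of_mem hU⟩
      · rintro a b ⟨U, hU, hab⟩ ⟨V, hV, ha⟩
        rcases hchain.total hU hV with hUV | hVU
        · exact ⟨V, hV, (hc hV).1.mp (hUV hab) ha⟩
        · exact ⟨U, hU, (hc hU).1.mp hab (hVU ha)⟩
      · rintro x ⟨U, hU, hx⟩
        exact (hc hU).2 x hx) T ⟨h, hTS⟩
  have hPT : IntTheory P := hP.prop.1
  -- By maximality, adding a formula outside `P` must derive an element of `S`.
  have key : ∀ a, a ∉ P → ∃ x ∈ S, a.imp x ∈ P := by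
    intro a ha
    by_contra! hcon
    have hsub : insert a P ⊆ {φ | MPClosure (insert a P) φ} := subset_mpClosure _
    have := hP.le_of_ge (y := {φ | MPClosure (insert a P) φ})
      ⟨(hPT.toIntSystem.mono (Set.subset_insert a P)).theory, fun x hx hxS =>
        hcon x hxS (hPT.deduction_insert hx)⟩ ((Set.subset_insert a P).trans hsub)
    exact ha (this (hsub (Set.mem_insert a P)))
  refine ⟨P, hTP, ⟨hPT, ?_, ?_⟩, hP.prop.2⟩
  · intro hbot
    exact hP.prop.2 _ (hPT.mp (hPT.exFalso _) hbot) hne.some_mem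
  · intro a b hab
    by_contra! hcon
    obtain ⟨x, hx, hax⟩ := key a hcon.1
    obtain ⟨y, hy, hby⟩ := key b hcon.2
    exact hP.prop.2 _ (hPT.mp (hPT.or_mono hax hby) hab) (hS x hx y hy)

theorem PrimeTheory.or_mem {T : Set (Form M)} (h : PrimeTheory T) : a.or b ∈ T ↔ a ∈ T ∨ b ∈ T :=
  ⟨h.prime, fun hab => hab.elim (h.mp (h.orLeft _ _)) (h.mp (h.orRight _ _))⟩

theorem PrimeTheory.bigOr_mem {T : Set (Form M)} (h : PrimeTheory T) :
    ∀ {l : List (Form M)}, bigOr l ∈ T → ∃ a ∈ l, a ∈ T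
  | [], hl => (h.consistent hl).elim
  | [a], hl => ⟨a, by simp, hl⟩
  | a :: b :: l, hl => by
    rcases h.prime hl with ha | hb
    · exact ⟨a, by simp, ha⟩
    · obtain ⟨x, hx, hxT⟩ := PrimeTheory.bigOr_mem h hb
      exact ⟨x, List.mem_cons_of_mem _ hx, hxT⟩

end Hilbert

/-! ### Kripke frames for intuitionistic modal logic -/

section Frames

/-- Intuitionistic forcing over the accessibility relation `R` and the valuation `V`. -/
def force {W : Type} [Preorder W] (R : W → W → Prop) (V : W → ℕ → Prop) : W → ModalForm → Prop
  | _, .bot => False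
  | w, .var p => V w p
  | w, .and φ ψ => force R V w φ ∧ force R V w ψ
  | w, .or φ ψ => force R V w φ ∨ force R V w ψ
  | w, .imp φ ψ => ∀ v, w ≤ v → force R V v φ → force R V v ψ
  | w, .box _ φ => ∀ v, R w v → force R V v φ

/-- Truth at all worlds under all persistent valuations. -/
def FrameValid {W : Type} [Preorder W] (R : W → W → Prop) (φ : ModalForm) : Prop :=
  ∀ V : W → ℕ → Prop, (∀ w v p, w ≤ v → V w p → V v p) → ∀ w, force R V w φ

variable {W : Type} [Preorder W] {R : W → W → Prop} {V : W → ℕ → Prop}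

/-- Boxes quantify over `R`-successors only, not over those of all larger worlds; `hR` is what keeps
them persistent. -/
theorem force_mono (hR : ∀ w v u, w ≤ v → R v u → R w u)
    (hV : ∀ w v p, w ≤ v → V w p → V v p) (φ : ModalForm) :
    ∀ {w v : W}, w ≤ v → force R V w φ → force R V v φ := by
  induction φ with
  | bot => exact fun _ h => h
  | var p => exact fun hwv h => hV _ _ p hwv h
  | and φ ψ ih₁ ih₂ => exact fun hwv h => ⟨ih₁ hwv h.1, ih₂ hwv h.2⟩
  | or φ ψ ih₁ ih₂ => exact fun hwv h => h.imp (ih₁ hwv) (ih₂ hwv)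
  | imp φ ψ _ _ => exact fun hwv h u hvu => h u (hwv.trans hvu)
  | box m φ _ => exact fun hwv h u hvu => h u (hR _ _ _ hwv hvu)

theorem force_subst (σ : ℕ → ModalForm) (φ : ModalForm) (w : W) :
    force R V w (φ.subst σ) ↔ force R (fun v p => force R V v (σ p)) w φ := by
  induction φ generalizing w with
  | bot => rfl
  | var p => rfl
  | and φ ψ ih₁ ih₂ => simp only [Form.subst, force, ih₁, ih₂]
  | or φ ψ ih₁ ih₂ => simp only [Form.subst, force, ih₁, ih₂]
  | imp φ ψ ih₁ ih₂ => simp only [Form.subst, force, ih₁, ih₂]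
  | box m φ ih => simp only [Form.subst, force, ih]

theorem force_bigAnd (l : List ModalForm) (w : W) :
    force R V w (bigAnd l) ↔ ∀ φ ∈ l, force R V w φ := by
  induction l with
  | nil => simp [bigAnd, neg, force]
  | cons φ l ih =>
    cases l with
    | nil => simp [bigAnd]
    | cons ψ l => simp only [bigAnd, force, ih, List.forall_mem_cons]

theorem force_bigOr (l : List ModalForm) (w : W) :
    force R V w (bigOr l) ↔ ∃ φ ∈ l, force R V w φ := by
  induction l with
  | nil => simp [bigOr, force]
  | cons φ l ih =>
    cases l with
    | nil => simp [bigOr]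
    | cons ψ l => simp only [bigOr, force, ih, List.exists_mem_cons_iff]

theorem FrameValid.mp {φ ψ : ModalForm} (h₁ : FrameValid R (φ.imp ψ)) (h₂ : FrameValid R φ) :
    FrameValid R ψ :=
  fun V hV w => h₁ V hV w w le_rfl (h₂ V hV w)

theorem frameValid_normalClosure (hR : ∀ w v u, w ≤ v → R v u → R w u) {Γ : Set ModalForm}
    (hΓ : ∀ φ ∈ Γ, FrameValid R φ) {φ : ModalForm} (h : NormalClosure Γ φ) : FrameValid R φ := by
  induction h with
  | base h => exact hΓ _ h
  | mp _ _ ih₁ ih₂ => exact ih₁.mp ih₂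
  | subst σ _ ih =>
    intro V hV w
    rw [force_subst]
    -- The valuation `p ↦ σ p` is persistent by `force_mono`, hence admissible.
    exact ih _ (fun _ _ p hwv => force_mono hR hV (σ p) hwv) w
  | nec _ ih => exact fun V hV _ v _ => ih V hV v

theorem frameValid_oplus (hR : ∀ w v u, w ≤ v → R v u → R w u) {Γ Δ : Set ModalForm}
    (hΓ : ∀ φ ∈ Γ, FrameValid R φ) (hΔ : ∀ φ ∈ Δ, FrameValid R φ) :
    ∀ φ ∈ oplus Γ Δ, FrameValid R φ :=
  fun _ h => frameValid_normalClosure hR (fun _ hφ => hφ.elim (hΓ _) (hΔ _)) h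

theorem frameValid_mpClosure {Γ : Set PropForm} (hΓ : ∀ φ ∈ Γ, FrameValid R (ofProp Unit φ))
    {φ : PropForm} (h : MPClosure Γ φ) : FrameValid R (ofProp Unit φ) := by
  induction h with
  | base h => exact hΓ _ h
  | mp _ _ ih₁ ih₂ => exact ih₁.mp ih₂

theorem frameValid_plus {Γ Δ : Set PropForm} (hΓ : ∀ φ ∈ Γ, FrameValid R (ofProp Unit φ))
    (hΔ : ∀ φ ∈ Δ, FrameValid R (ofProp Unit φ)) :
    ∀ φ ∈ plus Γ Δ, FrameValid R (ofProp Unit φ) :=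
  fun _ h => frameValid_mpClosure (fun _ hφ => hφ.elim (hΓ _) (hΔ _)) h

/-! ### Frame conditions for the propositional schemes. -/

theorem frameValid_IPC (hR : ∀ w v u, w ≤ v → R v u → R w u) :
    ∀ φ ∈ IPC, FrameValid R (ofProp Unit φ) := by
  refine fun φ h => frameValid_mpClosure (fun ψ hψ V hV w => ?_) h
  have mono := fun φ : ModalForm => @force_mono W _ R V hR hV φ
  cases hψ with
  | a1 φ ψ => exact fun v _ h u hvu _ => mono _ hvu h
  | a2 φ χ ψ =>
    exact fun v _ h u hvu h' x hux hx =>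
      h x (hvu.trans hux) hx x le_rfl (h' x hux hx)
  | a3 φ ψ => exact fun v _ h => h.1
  | a4 φ ψ => exact fun v _ h => h.2
  | a5 φ ψ => exact fun v _ h u hvu h' => ⟨mono _ hvu h, h'⟩
  | a6 φ ψ => exact fun v _ h => Or.inl h
  | a7 φ ψ => exact fun v _ h => Or.inr h
  | a8 φ ψ χ =>
    exact fun v _ h u hvu h' x hux hx =>
      hx.elim (h x (hvu.trans hux)) (h' x hux)
  | a9 φ => exact fun v _ h => h.elim

theorem frameValid_LIN (hR : ∀ w v u, w ≤ v → R v u → R w u)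
    (hlin : ∀ w v u : W, w ≤ v → w ≤ u → v ≤ u ∨ u ≤ v) :
    ∀ φ ∈ LIN, FrameValid R (ofProp Unit φ) := by
  rintro _ ⟨φ, ψ, rfl⟩ V hV w
  change (∀ v, w ≤ v → _ → _) ∨ (∀ v, w ≤ v → _ → _)
  by_contra! hcon
  obtain ⟨⟨v, hwv, hv, hv'⟩, u, hwu, hu, hu'⟩ := hcon
  rcases hlin w v u hwv hwu with h | h
  · exact hu' (force_mono hR hV _ h hv)
  · exact hv' (force_mono hR hV _ h hu)

theorem frameValid_WLEM (hR : ∀ w v u, w ≤ v → R v u → R w u)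
    (hdir : ∀ w v u : W, w ≤ v → w ≤ u → ∃ x, v ≤ x ∧ u ≤ x) :
    ∀ φ ∈ WLEM, FrameValid R (ofProp Unit φ) := by
  rintro _ ⟨φ, rfl⟩ V hV w
  change (∀ v, w ≤ v → (∀ u, v ≤ u → _ → False) → False) ∨ (∀ v, w ≤ v → _ → False)
  by_contra! hcon
  obtain ⟨⟨v, hwv, hv, -⟩, u, hwu, hu, -⟩ := hcon
  obtain ⟨x, hvx, hux⟩ := hdir w v u hwv hwu
  exact hv x hvx (force_mono hR hV _ hux hu)

/-! ### Finite disjunctions and conjunctions under renaming and substitution. -/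

theorem map_bigOr {M N : Type} (f : M → N) (l : List (Form M)) :
    (bigOr l).map f = bigOr (l.map (Form.map f)) := by
  induction l with
  | nil => rfl
  | cons a l ih => cases l with
    | nil => rfl
    | cons b l => simp only [bigOr, Form.map, ih, List.map_cons]

theorem map_bigAnd {M N : Type} (f : M → N) (l : List (Form M)) :
    (bigAnd l).map f = bigAnd (l.map (Form.map f)) := by
  induction l with
  | nil => rfl
  | cons a l ih => cases l with
    | nil => rfl
    | cons b l => simp only [bigAnd, Form.map, ih, List.map_cons]

theorem subst_bigOr {M : Type} (σ : ℕ → Form M) (l : List (Form M)) :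
    (bigOr l).subst σ = bigOr (l.map (Form.subst σ)) := by
  induction l with
  | nil => rfl
  | cons a l ih => cases l with
    | nil => rfl
    | cons b l => simp only [bigOr, Form.subst, ih, List.map_cons]

theorem subst_bigAnd {M : Type} (σ : ℕ → Form M) (l : List (Form M)) :
    (bigAnd l).subst σ = bigAnd (l.map (Form.subst σ)) := by
  induction l with
  | nil => rfl
  | cons a l ih => cases l with
    | nil => rfl
    | cons b l => simp only [bigAnd, Form.subst, ih, List.map_cons]

/-- The bounded chain scheme holds in upward linear frames without strict chains of length
`n + 1`. -/
theorem frameValid_BC (hR : ∀ w v u, w ≤ v → R v u → R w u) {n : ℕ}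
    (hlin : ∀ w v u : W, w ≤ v → w ≤ u → v ≤ u ∨ u ≤ v)
    (hchain : ∀ (w : W) (c : ℕ → W), (∀ i ≤ n, w ≤ c i) →
      ¬ ∀ i j, i < j → j ≤ n → c i ≤ c j ∧ ¬ c j ≤ c i) :
    ∀ φ ∈ BC n, FrameValid R (ofProp Unit φ) := by
  rintro _ ⟨f, rfl⟩ V hV w
  rw [ofProp, map_bigOr, force_bigOr]
  simp only [List.mem_map, List.mem_range, exists_exists_and_eq_and, Form.map, map_bigAnd,
    force, force_bigAnd, forall_exists_index, and_imp, forall_apply_eq_imp_iff₂]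
  by_contra! hcon
  have : Nonempty W := ⟨w⟩
  -- A world `c i` refuting the `i`-th disjunct forces all earlier formulas but not the `i`-th. So
  -- `c j ≤ c i` fails for `i < j`, and linearity orders the `n + 1` worlds strictly.
  choose! c hwc hc hc' using hcon
  refine hchain w c (fun i hi => hwc i (by omega)) fun i j hij hj => ?_
  have hnot : ¬ c j ≤ c i := fun hle =>
    hc' i (by omega) (force_mono hR hV _ hle (hc j (by omega) i hij))
  exact ⟨(hlin w _ _ (hwc i (by omega)) (hwc j (by omega))).resolve_right hnot, hnot⟩

theorem frameValid_modalK (hR : ∀ w v u, w ≤ v → R v u → R w u) {L : Set PropForm}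
    (hL : ∀ φ ∈ L, FrameValid R (ofProp Unit φ)) : ∀ φ ∈ modalK L, FrameValid R φ := by
  refine frameValid_oplus hR (frameValid_oplus hR ?_ ?_) ?_
  · rintro _ ⟨φ, hφ, rfl⟩
    exact frameValid_IPC hR φ hφ
  · rintro _ ⟨φ, ψ, rfl⟩ V _ w v _ h u hvu h' x hux
    exact h x (hR _ _ _ hvu hux) x le_rfl (h' x hux)
  · rintro _ ⟨φ, hφ, rfl⟩
    exact hL φ hφ

theorem frameValid_AxT (hrefl : ∀ w, R w w) : ∀ φ ∈ AxT, FrameValid R φ := by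
  rintro _ ⟨φ, rfl⟩ V _ w v _ h
  exact h v (hrefl v)

theorem frameValid_Ax4 (htrans : ∀ w v u, R w v → R v u → R w u) :
    ∀ φ ∈ Ax4, FrameValid R φ := by
  rintro _ ⟨φ, rfl⟩ V _ w v _ h u hvu x hux
  exact h x (htrans _ _ _ hvu hux)

end Frames

/-! ### Justification systems and their substitution properties -/

/-- Substitution of terms for justification variables. -/
def JTerm.subst (τ : ℕ → JTerm) : JTerm → JTerm
  | .var n => τ n
  | .const i => .const i
  | .sum t s => .sum (t.subst τ) (s.subst τ)
  | .app t s => .app (t.subst τ) (s.subst τ)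
  | .bang t => .bang (t.subst τ)

/-- Substitution of terms for justification variables in formulas. -/
abbrev Form.tsubst (τ : ℕ → JTerm) : JForm → JForm := Form.map (JTerm.subst τ)

theorem JTerm.subst_subst (σ τ : ℕ → JTerm) (t : JTerm) :
    (t.subst σ).subst τ = t.subst fun n => (σ n).subst τ := by
  induction t with
  | var n => rfl
  | const i => rfl
  | sum t s ih₁ ih₂ => simp only [JTerm.subst, ih₁, ih₂]
  | app t s ih₁ ih₂ => simp only [JTerm.subst, ih₁, ih₂]
  | bang t ih => simp only [JTerm.subst, ih]

theorem tsubst_tsubst (σ τ : ℕ → JTerm) (φ : JForm) :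
    (φ.tsubst σ).tsubst τ = φ.tsubst fun n => (σ n).subst τ := by
  induction φ with
  | bot => rfl
  | var p => rfl
  | and φ ψ ih₁ ih₂ => simp only [Form.map, ih₁, ih₂]
  | or φ ψ ih₁ ih₂ => simp only [Form.map, ih₁, ih₂]
  | imp φ ψ ih₁ ih₂ => simp only [Form.map, ih₁, ih₂]
  | box t φ ih => simp only [Form.map, ih, JTerm.subst_subst]

theorem tsubst_subst_ofProp (τ : ℕ → JTerm) (σ : ℕ → JForm) (φ : PropForm) :
    ((ofProp JTerm φ).subst σ).tsubst τ =
      (ofProp JTerm φ).subst fun p => (σ p).tsubst τ := by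
  unfold ofProp
  induction φ with
  | bot => rfl
  | var p => rfl
  | and φ ψ ih₁ ih₂ => simp only [Form.map, Form.subst, ih₁, ih₂]
  | or φ ψ ih₁ ih₂ => simp only [Form.map, Form.subst, ih₁, ih₂]
  | imp φ ψ ih₁ ih₂ => simp only [Form.map, Form.subst, ih₁, ih₂]
  | box t φ _ => exact t.elim

/-- Closure under substitution for justification variables. -/
def TSubstClosed (A : Set JForm) : Prop := ∀ τ, ∀ φ ∈ A, φ.tsubst τ ∈ A

theorem TSubstClosed.union {A B : Set JForm} (hA : TSubstClosed A) (hB : TSubstClosed B) :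
    TSubstClosed (A ∪ B) :=
  fun τ φ h => h.imp (hA τ φ) (hB τ φ)

theorem tsubstClosed_substClosure (L : Set PropForm) : TSubstClosed (substClosure L) := by
  rintro τ _ ⟨φ, σ, hφ, rfl⟩
  exact ⟨φ, _, hφ, tsubst_subst_ofProp τ σ φ⟩

theorem tsubstClosed_AxJ : TSubstClosed AxJ := by
  rintro τ _ ⟨t, s, φ, ψ, rfl⟩
  exact ⟨t.subst τ, s.subst τ, φ.tsubst τ, ψ.tsubst τ, rfl⟩

theorem tsubstClosed_AxSum : TSubstClosed AxSum := by
  rintro τ _ ⟨t, s, φ, rfl | rfl⟩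
  · exact ⟨t.subst τ, s.subst τ, φ.tsubst τ, Or.inl rfl⟩
  · exact ⟨t.subst τ, s.subst τ, φ.tsubst τ, Or.inr rfl⟩

theorem tsubstClosed_AxF : TSubstClosed AxF := by
  rintro τ _ ⟨t, φ, rfl⟩
  exact ⟨t.subst τ, φ.tsubst τ, rfl⟩

theorem tsubstClosed_AxI : TSubstClosed AxI := by
  rintro τ _ ⟨t, φ, rfl⟩
  exact ⟨t.subst τ, φ.tsubst τ, rfl⟩

/-- Substitution for justification variables leaves the constants in front untouched. -/
theorem tsubstClosed_TCS {A : Set JForm} (hA : TSubstClosed A) : TSubstClosed {φ | TCS A φ} := by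
  intro τ φ h
  induction h with
  | base i h => exact TCS.base i (hA τ _ h)
  | step i _ ih => exact TCS.step i ih

/-- A set of axioms of a justification logic. -/
structure JustSystem (A : Set JForm) : Prop extends IntSystem A where
  application : AxJ ⊆ A
  sum : AxSum ⊆ A
  tsubst : TSubstClosed A

/-- Every instance in the justification language comes from the axiom in the variables `p_0, p_1,
p_2`. Arguments of `σ` repeated for shorter schemes are mere fillers. -/
theorem intSystem_substClosure {L : Set PropForm} (hL : IPC ⊆ L) : IntSystem (substClosure L) := by
  have key : ∀ (φ : PropForm) (σ : ℕ → JForm), IntAxiom φ →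
      (ofProp JTerm φ).subst σ ∈ substClosure L :=
    fun φ σ h => ⟨φ, σ, hL (.base h), rfl⟩
  let σ (a b c : JForm) : ℕ → JForm
    | 0 => a
    | 1 => b
    | _ => c
  exact
    { k := fun a b => key _ (σ a b a) (.a1 (.var 0) (.var 1))
      s := fun a b c => key _ (σ a b c) (.a2 (.var 0) (.var 1) (.var 2))
      andLeft := fun a b => key _ (σ a b a) (.a3 (.var 0) (.var 1))
      andRight := fun a b => key _ (σ a b a) (.a4 (.var 0) (.var 1))
      andIntro := fun a b => key _ (σ a b a) (.a5 (.var 0) (.var 1))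
      orLeft := fun a b => key _ (σ a b a) (.a6 (.var 0) (.var 1))
      orRight := fun a b => key _ (σ a b a) (.a7 (.var 0) (.var 1))
      orElim := fun a b c => key _ (σ a b c) (.a8 (.var 0) (.var 1) (.var 2))
      exFalso := fun a => key _ (σ a a a) (.a9 (.var 0)) }

/-- The theorems of the justification logic, as the closure of the axioms and the constant
specification under modus ponens. -/
def justTheorems (A : Set JForm) : Set JForm := {φ | MPClosure (A ∪ {γ | TCS A γ}) φ}

theorem mem_justTheorems {A : Set JForm} {φ : JForm} (h : φ ∈ A) : φ ∈ justTheorems A :=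
  .base (Or.inl h)

section System

variable {A : Set JForm} (hA : JustSystem A)
include hA

theorem JustSystem.theory : IntTheory (justTheorems A) :=
  (hA.toIntSystem.mono Set.subset_union_left).theory

/-- A derivation uses finitely many members of the constant specification; they are collected in a
list, and modus ponens concatenates two lists. -/
theorem JustSystem.justTheorems_subset : justTheorems A ⊆ justLogic A := by
  have hT : IntTheory {φ | MPClosure A φ} := hA.toIntSystem.theory
  intro φ h
  induction h with
  | @base φ h =>
    rcases h with h | h
    · exact ⟨[], by simp, hT.weaken (.base h) _⟩
    · exact ⟨[φ], by simpa using h, hT.refl φ⟩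
  | mp _ _ ih₁ ih₂ =>
    obtain ⟨l₁, h₁, h₁'⟩ := ih₁
    obtain ⟨l₂, h₂, h₂'⟩ := ih₂
    refine ⟨l₁ ++ l₂, fun γ hγ => (List.mem_append.1 hγ).elim (h₁ γ) (h₂ γ), ?_⟩
    exact hT.app
      (hT.trans (hT.imp_bigAnd fun b hb => hT.bigAnd_imp (List.mem_append_left _ hb)) h₁')
      (hT.trans (hT.imp_bigAnd fun b hb => hT.bigAnd_imp (List.mem_append_right _ hb)) h₂')

theorem JustSystem.tsubst_mem (τ : ℕ → JTerm) {φ : JForm} (h : φ ∈ justTheorems A) :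
    φ.tsubst τ ∈ justTheorems A := by
  induction h with
  | base h => exact .base (hA.tsubst.union (tsubstClosed_TCS hA.tsubst) τ _ h)
  | mp _ _ ih₁ ih₂ => exact .mp ih₁ ih₂

/-- Internalization: a theorem has a closed term that justifies all its substitution instances. -/
theorem JustSystem.internalize {φ : JForm} (h : φ ∈ justTheorems A) :
    ∃ u : JTerm, (∀ τ, u.subst τ = u) ∧ ∀ τ, box u (φ.tsubst τ) ∈ justTheorems A := by
  induction h with
  | base h =>
    -- The specification is total, so one constant justifies every axiom and every member of the
    -- specification.
    refine ⟨.const 0, fun _ => rfl, fun τ => .base (Or.inr ?_)⟩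
    rcases h with h | h
    · exact TCS.base 0 (hA.tsubst τ _ h)
    · exact TCS.step 0 (tsubstClosed_TCS hA.tsubst τ _ h)
  | mp _ _ ih₁ ih₂ =>
    obtain ⟨u, hu, hu'⟩ := ih₁
    obtain ⟨v, hv, hv'⟩ := ih₂
    refine ⟨u.app v, fun τ => by simp only [JTerm.subst, hu, hv], fun τ => ?_⟩
    exact .mp (.mp (mem_justTheorems (hA.application ⟨u, v, _, _, rfl⟩)) (hu' τ)) (hv' τ)

/-- Finitely many theorems have a common closed term that justifies all their substitution
instances. -/
theorem JustSystem.internalize_finite {S : Set JForm} (hS : S.Finite) :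
    S ⊆ justTheorems A →
    ∃ u : JTerm, (∀ τ, u.subst τ = u) ∧ ∀ φ ∈ S, ∀ τ, box u (φ.tsubst τ) ∈ justTheorems A := by
  induction S, hS using Set.Finite.induction_on with
  | empty => exact fun _ => ⟨.const 0, fun _ => rfl, by simp⟩
  | @insert φ S _ _ ih =>
    intro h
    obtain ⟨u, hu, hu'⟩ := ih ((Set.subset_insert _ _).trans h)
    obtain ⟨v, hv, hv'⟩ := hA.internalize (h (Set.mem_insert _ _))
    refine ⟨v.sum u, fun τ => by simp only [JTerm.subst, hu, hv], ?_⟩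
    rintro ψ (rfl | hψ) τ
    · exact .mp (mem_justTheorems (hA.sum ⟨v, u, _, Or.inl rfl⟩)) (hv' τ)
    · exact .mp (mem_justTheorems (hA.sum ⟨u, v, _, Or.inr rfl⟩)) (hu' ψ hψ τ)

end System

/-! ### Quasi-realizations -/

/-- The connective that combines several realizations: `∧` at polarity `T`, `∨` at `F`. -/
def Pol.comb : Pol → JForm → JForm → JForm
  | .T => Form.and
  | .F => Form.or

/-- The closure of a set of formulas under the connective `s.comb`. -/
inductive CombClosure (s : Pol) (X : Set JForm) : JForm → Prop where
  | base {α : JForm} : α ∈ X → CombClosure s X α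
  | comb {α β : JForm} :
      CombClosure s X α → CombClosure s X β → CombClosure s X (s.comb α β)

/-- The basic quasi-realizations of an annotated formula: as realizations, but finitely many
quasi-realizations of an immediate subformula may be combined into one. -/
def basicQuasi : Pol → AnnForm → Set JForm
  | _, .bot => {.bot}
  | _, .var p => {.var p}
  | s, .and φ ψ => {χ | ∃ α β, CombClosure s (basicQuasi s φ) α ∧
      CombClosure s (basicQuasi s ψ) β ∧ χ = α.and β}
  | s, .or φ ψ => {χ | ∃ α β, CombClosure s (basicQuasi s φ) α ∧
      CombClosure s (basicQuasi s ψ) β ∧ χ = α.or β}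
  | s, .imp φ ψ => {χ | ∃ α β, CombClosure s.flip (basicQuasi s.flip φ) α ∧
      CombClosure s (basicQuasi s ψ) β ∧ χ = α.imp β}
  | .T, .box n φ => {χ | ∃ α, CombClosure .T (basicQuasi .T φ) α ∧ χ = box (JTerm.var n) α}
  | .F, .box _ φ => {χ | ∃ α t, CombClosure .F (basicQuasi .F φ) α ∧ χ = box t α}

/-- The quasi-realizations of an annotated formula. -/
def quasi (s : Pol) (φ : AnnForm) : Set JForm := {α | CombClosure s (basicQuasi s φ) α}

theorem quasi_nonempty (φ : AnnForm) : ∀ s, (quasi s φ).Nonempty := by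
  induction φ with
  | bot => exact fun s => ⟨.bot, .base (by simp [basicQuasi])⟩
  | var p => exact fun s => ⟨.var p, .base (by simp [basicQuasi])⟩
  | and φ ψ ih₁ ih₂ =>
    exact fun s =>
      ⟨_, .base (by rw [basicQuasi]; exact ⟨_, _, (ih₁ s).some_mem, (ih₂ s).some_mem, rfl⟩)⟩
  | or φ ψ ih₁ ih₂ =>
    exact fun s =>
      ⟨_, .base (by rw [basicQuasi]; exact ⟨_, _, (ih₁ s).some_mem, (ih₂ s).some_mem, rfl⟩)⟩
  | imp φ ψ ih₁ ih₂ =>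
    exact fun s =>
      ⟨_, .base (by rw [basicQuasi]; exact ⟨_, _, (ih₁ s.flip).some_mem, (ih₂ s).some_mem, rfl⟩)⟩
  | box n φ ih =>
    rintro (_ | _)
    · exact ⟨_, .base (by rw [basicQuasi]; exact ⟨_, (ih .T).some_mem, rfl⟩)⟩
    · exact ⟨_, .base (by rw [basicQuasi]; exact ⟨_, .const 0, (ih .F).some_mem, rfl⟩)⟩

section QuasiIntro

variable {s : Pol} {φ ψ : AnnForm} {α β : JForm}

theorem and_mem_quasi (hα : α ∈ quasi s φ) (hβ : β ∈ quasi s ψ) : α.and β ∈ quasi s (φ.and ψ) :=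
  .base (by rw [basicQuasi]; exact ⟨α, β, hα, hβ, rfl⟩)

theorem or_mem_quasi (hα : α ∈ quasi s φ) (hβ : β ∈ quasi s ψ) : α.or β ∈ quasi s (φ.or ψ) :=
  .base (by rw [basicQuasi]; exact ⟨α, β, hα, hβ, rfl⟩)

theorem imp_mem_quasi (hα : α ∈ quasi s.flip φ) (hβ : β ∈ quasi s ψ) :
    α.imp β ∈ quasi s (φ.imp ψ) :=
  .base (by rw [basicQuasi]; exact ⟨α, β, hα, hβ, rfl⟩)

theorem box_mem_quasi_T (n : ℕ) (hα : α ∈ quasi .T φ) :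
    box (JTerm.var n) α ∈ quasi .T (.box n φ) :=
  .base (by rw [basicQuasi]; exact ⟨α, hα, rfl⟩)

theorem box_mem_quasi_F (n : ℕ) (t : JTerm) (hα : α ∈ quasi .F φ) :
    box t α ∈ quasi .F (.box n φ) :=
  .base (by rw [basicQuasi]; exact ⟨α, t, hα, rfl⟩)

end QuasiIntro

/-! ### The canonical model -/

/-- Worlds of the canonical model: prime theories that contain the justification logic. -/
def World (A : Set JForm) : Type :=
  {Γ : Set JForm // PrimeTheory Γ ∧ justTheorems A ⊆ Γ}

instance (A : Set JForm) : PartialOrder (World A) := inferInstanceAs (PartialOrder (Subtype _))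

/-- The formulas justified in `Γ` by some term. -/
def justified (Γ : Set JForm) : Set JForm := {α | ∃ t, box t α ∈ Γ}

/-- Canonical accessibility. -/
def World.Rel {A : Set JForm} (w v : World A) : Prop := justified w.1 ⊆ v.1

/-- Canonical valuation. -/
def World.val {A : Set JForm} (w : World A) (p : ℕ) : Prop := Form.var p ∈ w.1

section Canonical

variable {A : Set JForm}

theorem World.rel_of_le (w v u : World A) (hwv : w ≤ v) (hvu : v.Rel u) : w.Rel u :=
  fun _ ⟨t, ht⟩ => hvu ⟨t, hwv ht⟩

theorem exists_world {T S : Set JForm} (h : IntTheory T) (hne : S.Nonempty)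
    (hS : ∀ x ∈ S, ∀ y ∈ S, x.or y ∈ S) (hTS : ∀ x ∈ T, x ∉ S) (hT : justTheorems A ⊆ T) :
    ∃ v : World A, T ⊆ v.1 ∧ ∀ x ∈ v.1, x ∉ S := by
  obtain ⟨P, hTP, hP, hPS⟩ := h.exists_prime hne hS hTS
  exact ⟨⟨P, hP, hT.trans hTP⟩, hTP, hPS⟩

/-- Constants justify the axioms, and the application axiom gives closure under modus ponens. This
lets `exists_world` produce accessible worlds. -/
theorem justified_theory (hA : JustSystem A) (w : World A) : IntTheory (justified w.1) := by
  refine ⟨hA.toIntSystem.mono fun α h => ⟨.const 0, w.2.2 (.base (Or.inr (TCS.base 0 h)))⟩, ?_⟩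
  rintro a b ⟨t, ht⟩ ⟨s, hs⟩
  exact ⟨t.app s, w.2.1.mp (w.2.1.mp (w.2.2 (mem_justTheorems (hA.application
    ⟨t, s, a, b, rfl⟩))) ht) hs⟩

theorem justTheorems_subset_justified (hA : JustSystem A) (w : World A) :
    justTheorems A ⊆ justified w.1 := by
  refine fun φ h => (justified_theory hA w).mpClosure_subset ?_ h
  rintro α (h | h)
  · exact ⟨.const 0, w.2.2 (.base (Or.inr (TCS.base 0 h)))⟩
  · exact ⟨.const 0, w.2.2 (.base (Or.inr (TCS.step 0 h)))⟩

/-- If all quasi-realizations of `φ` at polarity `T` belong to a world, then `φ` is forced there,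
and if `φ` is forced at a world, then some quasi-realization of `φ` at polarity `F` belongs to
it. -/
theorem truth_lemma (hA : JustSystem A) (φ : AnnForm) :
    (∀ w : World A, quasi .T φ ⊆ w.1 → force World.Rel World.val w (φ.map fun _ => ())) ∧
    (∀ w : World A, force World.Rel World.val w (φ.map fun _ => ()) →
      ∃ α ∈ quasi .F φ, α ∈ w.1) := by
  induction φ with
  | bot =>
    exact ⟨fun w h => w.2.1.consistent (h (.base (by simp [basicQuasi]))), fun w h => h.elim⟩
  | var p =>
    exact ⟨fun w h => h (.base (by simp [basicQuasi])),
      fun w h => ⟨_, .base (by simp [basicQuasi]), h⟩⟩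
  | and φ ψ ih₁ ih₂ =>
    refine ⟨fun w h => ⟨ih₁.1 w fun α hα => ?_, ih₂.1 w fun β hβ => ?_⟩, fun w h => ?_⟩
    · exact (w.2.1.and_mem.1 (h (and_mem_quasi hα (quasi_nonempty ψ .T).some_mem))).1
    · exact (w.2.1.and_mem.1 (h (and_mem_quasi (quasi_nonempty φ .T).some_mem hβ))).2
    · obtain ⟨α, hα, hαw⟩ := ih₁.2 w h.1
      obtain ⟨β, hβ, hβw⟩ := ih₂.2 w h.2
      exact ⟨_, and_mem_quasi hα hβ, w.2.1.and_mem.2 ⟨hαw, hβw⟩⟩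
  | or φ ψ ih₁ ih₂ =>
    refine ⟨fun w h => ?_, fun w h => ?_⟩
    · by_cases hφ : quasi .T φ ⊆ w.1
      · exact Or.inl (ih₁.1 w hφ)
      · obtain ⟨α, hα, hαw⟩ := Set.not_subset.1 hφ
        -- One `α` missing from `w` serves for all `β`: primeness applied to `α ∨ β` puts each `β`
        -- into `w`.
        exact Or.inr (ih₂.1 w fun β hβ =>
          (w.2.1.prime (h (or_mem_quasi hα hβ))).resolve_left hαw)
    · rcases h with h | h
      · obtain ⟨α, hα, hαw⟩ := ih₁.2 w h
        exact ⟨_, or_mem_quasi hα (quasi_nonempty ψ .F).some_mem, w.2.1.or_mem.2 (Or.inl hαw)⟩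
      · obtain ⟨β, hβ, hβw⟩ := ih₂.2 w h
        exact ⟨_, or_mem_quasi (quasi_nonempty φ .F).some_mem hβ, w.2.1.or_mem.2 (Or.inr hβw)⟩
  | imp φ ψ ih₁ ih₂ =>
    refine ⟨fun w h v hwv hv => ?_, fun w h => ?_⟩
    · obtain ⟨α, hα, hαv⟩ := ih₁.2 v hv
      exact ih₂.1 v fun β hβ => v.2.1.mp (hwv (h (imp_mem_quasi hα hβ))) hαv
    · by_contra! hcon
      -- A world above `w` containing all of `quasi .T φ` and avoiding `quasi .F ψ`: otherwise the
      -- deduction theorem would put some quasi-realization `α → β` into `w`.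
      obtain ⟨v, hTv, hv⟩ := exists_world (A := A)
        (w.2.1.toIntSystem.mono (Set.subset_union_left (t := quasi .T φ))).theory
        (quasi_nonempty ψ .F) (fun _ hx _ hy => .comb hx hy) (by
          intro β hβ hβF
          obtain ⟨α, hα, hαβ⟩ := w.2.1.deduction (quasi_nonempty φ .T)
            (fun _ hx _ hy => .comb hx hy) hβ
          exact hcon _ (imp_mem_quasi hα hβF) hαβ)
        (w.2.2.trans (Set.subset_union_left.trans (subset_mpClosure _)))
      have hsub := (subset_mpClosure _).trans hTv
      obtain ⟨β, hβ, hβv⟩ := ih₂.2 v (h v (Set.subset_union_left.trans hsub)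
        (ih₁.1 v (Set.subset_union_right.trans hsub)))
      exact hv β hβv hβ
  | box n φ ih =>
    refine ⟨fun w h v hwv => ih.1 v fun α hα => hwv ⟨_, h (box_mem_quasi_T n hα)⟩, fun w h => ?_⟩
    by_contra! hcon
    -- The formulas justified in `w` avoid `quasi .F φ`, as any term justifying such an `α` would
    -- give a quasi-realization of the box in `w`.
    obtain ⟨v, hTv, hv⟩ := exists_world (A := A) (justified_theory hA w) (quasi_nonempty φ .F)
      (fun _ hx _ hy => .comb hx hy)
      (fun α ⟨t, ht⟩ hα => hcon _ (box_mem_quasi_F n t hα) ht)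
      (justTheorems_subset_justified hA w)
    obtain ⟨α, hα, hαv⟩ := ih.2 v (h v hTv)
    exact hv α hαv hα

/-- A modal formula valid in the canonical frame has a provable quasi-realization. -/
theorem exists_quasi_mem (hA : JustSystem A) {φ : AnnForm}
    (hφ : FrameValid (World.Rel (A := A)) (φ.map fun _ => ())) :
    ∃ α ∈ quasi .F φ, α ∈ justTheorems A := by
  by_contra! hcon
  obtain ⟨w, -, hw⟩ := exists_world (A := A) hA.theory (quasi_nonempty φ .F)
    (fun _ hx _ hy => .comb hx hy) (fun α hα hαF => hcon α hαF hα) subset_rfl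
  obtain ⟨α, hα, hαw⟩ := (truth_lemma hA φ).2 w (hφ World.val (fun _ _ _ hwv h => hwv h) w)
  exact hw α hαw hα

/-! ### Properties of the canonical frame -/

theorem World.rel_refl (hF : AxF ⊆ A) (w : World A) : w.Rel w :=
  fun α ⟨t, ht⟩ => w.2.1.mp (w.2.2 (mem_justTheorems (hF ⟨t, α, rfl⟩))) ht

theorem World.rel_trans (hI : AxI ⊆ A) (w v u : World A) (hwv : w.Rel v) (hvu : v.Rel u) :
    w.Rel u :=
  fun α ⟨t, ht⟩ => hvu ⟨t, hwv ⟨t.bang, w.2.1.mp (w.2.2 (mem_justTheorems (hI ⟨t, α, rfl⟩))) ht⟩⟩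

theorem World.linear {L : Set PropForm} (hL : LIN ⊆ L) (hLA : substClosure L ⊆ A)
    (w v u : World A) (hwv : w ≤ v) (hwu : w ≤ u) : v ≤ u ∨ u ≤ v := by
  by_contra! hcon
  obtain ⟨α, hαv, hαu⟩ := Set.not_subset.1 hcon.1
  obtain ⟨β, hβu, hβv⟩ := Set.not_subset.1 hcon.2
  have h : (α.imp β).or (β.imp α) ∈ w.1 := w.2.2 (mem_justTheorems (hLA
    ⟨_, fun p => if p = 0 then α else β, hL ⟨.var 0, .var 1, rfl⟩, rfl⟩))
  rcases w.2.1.prime h with h | h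
  · exact hβv (v.2.1.mp (hwv h) hαv)
  · exact hαu (u.2.1.mp (hwu h) hβu)

/-- If `v ∪ u` were inconsistent, some `α ∈ u` would have `¬α ∈ v`; then neither disjunct of `¬¬α ∨
¬α` could lie in `w`. The set to avoid is the closure of `⊥` under `∨`, all of whose members imply
`⊥`. -/
theorem World.directed {L : Set PropForm} (hL : WLEM ⊆ L) (hLA : substClosure L ⊆ A)
    (w v u : World A) (hwv : w ≤ v) (hwu : w ≤ u) : ∃ x, v ≤ x ∧ u ≤ x := by
  obtain ⟨x, hx, -⟩ := exists_world (A := A) (S := {α | CombClosure .F {(.bot : JForm)} α})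
    (v.2.1.toIntSystem.mono (Set.subset_union_left (t := u.1))).theory
    ⟨.bot, .base rfl⟩ (fun _ hx _ hy => .comb hx hy) (by
      intro β hβ hβF
      have hbot : β.imp .bot ∈ v.1 := by
        clear hβ
        induction hβF with
        | base h => rw [Set.mem_singleton_iff.1 h]; exact v.2.1.refl _
        | comb _ _ ih₁ ih₂ => exact v.2.1.or_elim ih₁ ih₂
      obtain ⟨α, hα, hαβ⟩ := v.2.1.deduction ⟨_, u.2.1.refl .bot⟩
        (fun _ hx _ hy => u.2.1.and_mem.2 ⟨hx, hy⟩) hβ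
      have h : α.neg.neg.or α.neg ∈ w.1 := w.2.2 (mem_justTheorems (hLA
        ⟨_, fun _ => α, hL ⟨.var 0, rfl⟩, rfl⟩))
      rcases w.2.1.prime h with h | h
      · exact v.2.1.consistent (v.2.1.mp (hwv h) (v.2.1.trans hαβ hbot))
      · exact u.2.1.consistent (u.2.1.mp (hwu h) hα))
    (v.2.2.trans (Set.subset_union_left.trans (subset_mpClosure _)))
  have hsub := (subset_mpClosure _).trans hx
  exact ⟨x, Set.subset_union_left.trans hsub, Set.subset_union_right.trans hsub⟩

/-- Separate consecutive worlds by formulas `f i ∈ c (i + 1)` outside `c i`. Some disjunct of the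
scheme for `f` lies in `w`, hence in `c i` for its index `i`, together with its premises; so `f i ∈
c i`. -/
theorem World.no_chain {L : Set PropForm} {n : ℕ} (hL : BC n ⊆ L) (hLA : substClosure L ⊆ A)
    (w : World A) (c : ℕ → World A) (hw : ∀ i ≤ n, w ≤ c i)
    (hc : ∀ i j, i < j → j ≤ n → c i ≤ c j ∧ ¬ c j ≤ c i) : False := by
  have hex : ∀ i, ∃ α : JForm, α ∉ (c i).1 ∧ (i < n → α ∈ (c (i + 1)).1) := by
    intro i
    by_cases hi : i < n
    · obtain ⟨α, hα, hα'⟩ := Set.not_subset.1 (hc i (i + 1) (by omega) (by omega)).2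
      exact ⟨α, hα', fun _ => hα⟩
    -- The last world has no successor in the chain; `⊥` is the formula it omits.
    · exact ⟨.bot, (c i).2.1.consistent, fun h => (hi h).elim⟩
  choose f hf hf' using hex
  have h : bigOr ((List.range (n + 1)).map fun i =>
      (bigAnd ((List.range i).map f)).imp (f i)) ∈ w.1 := by
    refine w.2.2 (mem_justTheorems (hLA ⟨_, f, hL ⟨.var, rfl⟩, ?_⟩))
    simp only [ofProp, map_bigOr, subst_bigOr, map_bigAnd, subst_bigAnd, List.map_map,
      Function.comp_def, Form.map, Form.subst]
  obtain ⟨α, hα, hαw⟩ := w.2.1.bigOr_mem h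
  obtain ⟨i, hi, rfl⟩ := List.mem_map.1 hα
  rw [List.mem_range] at hi
  refine hf i ((c i).2.1.mp (hw i (by omega) hαw) ((c i).2.1.bigAnd_mem fun b hb => ?_))
  obtain ⟨j, hj, rfl⟩ := List.mem_map.1 hb
  rw [List.mem_range] at hj
  have hmem := hf' j (by omega)
  rcases Nat.lt_or_ge (j + 1) i with hlt | hge
  · exact (hc _ _ hlt (by omega)).1 hmem
  · rwa [show i = j + 1 by omega]

end Canonical

/-! ### From quasi-realizations to realizations -/

/-- Provable implication between quasi-realizations and a realization `γ`: from `α` to `γ` at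
polarity `F`, from `γ` to `α` at polarity `T`. -/
def Pol.Bounds (A : Set JForm) : Pol → JForm → JForm → Prop
  | .T, γ, α => γ.imp α ∈ justTheorems A
  | .F, γ, α => α.imp γ ∈ justTheorems A

/-- A substitution that is the identity outside `l` and whose value at `n` involves no variable
but `x_n`. -/
structure LivesOn (σ : ℕ → JTerm) (l : List ℕ) : Prop where
  eq_var : ∀ n ∉ l, σ n = .var n
  no_new : ∀ (n : ℕ) (τ : ℕ → JTerm), τ n = .var n → (σ n).subst τ = σ n

/-- Each value involves at most its own variable, which the other substitution fixes when the
supports are disjoint. So the two commute, and either order of composition gives `ρ`. -/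
theorem LivesOn.merge {σ τ : ℕ → JTerm} {l m : List ℕ} (hσ : LivesOn σ l) (hτ : LivesOn τ m)
    (hlm : l.Disjoint m) :
    ∃ ρ, LivesOn ρ (l ++ m) ∧ (∀ n, (σ n).subst τ = ρ n) ∧ ∀ n, (τ n).subst σ = ρ n := by
  refine ⟨fun n => (σ n).subst τ, ⟨fun n hn => ?_, fun n ρ hρ => ?_⟩, fun _ => rfl, fun n => ?_⟩
  · rw [List.mem_append, not_or] at hn
    rw [hσ.eq_var n hn.1]
    exact hτ.eq_var n hn.2
  · by_cases hn : n ∈ l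
    · rw [hσ.no_new n τ (hτ.eq_var n (hlm hn)), hσ.no_new n ρ hρ]
    · rw [hσ.eq_var n hn]
      exact hτ.no_new n ρ hρ
  · change _ = (σ n).subst τ
    by_cases hn : n ∈ l
    · rw [hσ.no_new n τ (hτ.eq_var n (hlm hn)), hτ.eq_var n (hlm hn)]
      rfl
    · rw [hτ.no_new n σ (hσ.eq_var n hn), hσ.eq_var n hn]
      rfl

/-- Only the variables at polarity `T` are prescribed, and `τ` fixes them; terms at polarity `F` may
change freely. -/
theorem tsubst_mem_realizations {τ : ℕ → JTerm} (φ : AnnForm) :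
    ∀ {s : Pol} {α : JForm}, (∀ n ∈ φ.modalities, τ n = .var n) → α ∈ realizations s φ →
      α.tsubst τ ∈ realizations s φ := by
  induction φ with
  | bot => intro s α _ h; simp only [realizations, Set.mem_singleton_iff] at h ⊢; rw [h]; rfl
  | var p => intro s α _ h; simp only [realizations, Set.mem_singleton_iff] at h ⊢; rw [h]; rfl
  | and φ ψ ih₁ ih₂ =>
    intro s α hτ h
    simp only [realizations, modalities, List.mem_append] at h hτ ⊢
    obtain ⟨β, hβ, γ, hγ, rfl⟩ := h
    exact ⟨_, ih₁ (fun n hn => hτ n (Or.inl hn)) hβ, _, ih₂ (fun n hn => hτ n (Or.inr hn)) hγ, rfl⟩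
  | or φ ψ ih₁ ih₂ =>
    intro s α hτ h
    simp only [realizations, modalities, List.mem_append] at h hτ ⊢
    obtain ⟨β, hβ, γ, hγ, rfl⟩ := h
    exact ⟨_, ih₁ (fun n hn => hτ n (Or.inl hn)) hβ, _, ih₂ (fun n hn => hτ n (Or.inr hn)) hγ, rfl⟩
  | imp φ ψ ih₁ ih₂ =>
    intro s α hτ h
    simp only [realizations, modalities, List.mem_append] at h hτ ⊢
    obtain ⟨β, hβ, γ, hγ, rfl⟩ := h
    exact ⟨_, ih₁ (fun n hn => hτ n (Or.inl hn)) hβ, _, ih₂ (fun n hn => hτ n (Or.inr hn)) hγ, rfl⟩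
  | box m φ ih =>
    intro s α hτ h
    simp only [modalities, List.mem_cons] at hτ
    cases s with
    | T =>
      simp only [realizations] at h ⊢
      obtain ⟨β, hβ, rfl⟩ := h
      refine ⟨_, ih (fun n hn => hτ n (Or.inr hn)) hβ, ?_⟩
      simp only [Form.map, JTerm.subst, hτ m (Or.inl rfl)]
    | F =>
      simp only [realizations] at h ⊢
      obtain ⟨β, hβ, t, rfl⟩ := h
      exact ⟨_, ih (fun n hn => hτ n (Or.inr hn)) hβ, _, rfl⟩

/-- Finitely many quasi-realizations of `φ` are bounded, after a substitution, by a
realization. -/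
def Convertible (A : Set JForm) (s : Pol) (φ : AnnForm) (S : Set JForm) : Prop :=
  ∃ σ, LivesOn σ φ.modalities ∧ ∃ γ ∈ realizations s φ, ∀ α ∈ S, s.Bounds A γ (α.tsubst σ)

/-- The first argument of a binary connective. -/
def Form.left : JForm → JForm
  | .and α _ => α
  | .or α _ => α
  | .imp α _ => α
  | α => α

/-- The last argument of a connective or modality. -/
def Form.right : JForm → JForm
  | .and _ β => β
  | .or _ β => β
  | .imp _ β => β
  | .box _ β => β
  | α => α

section Conversion

variable {A : Set JForm} (hA : JustSystem A)
include hA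

theorem JustSystem.bounds_tsubst (τ : ℕ → JTerm) {s : Pol} {γ α : JForm} (h : s.Bounds A γ α) :
    s.Bounds A (γ.tsubst τ) (α.tsubst τ) := by
  cases s <;> exact hA.tsubst_mem τ h

/-- Finitely many combinations of elements of `X` are bounded as soon as finitely many elements
of `X` are. -/
theorem JustSystem.exists_finite_basis {s : Pol} {X S : Set JForm} (hS : S.Finite) :
    (∀ α ∈ S, CombClosure s X α) → ∃ Y ⊆ X, Y.Finite ∧ ∀ (σ : ℕ → JTerm) (γ : JForm),
      (∀ α ∈ Y, s.Bounds A γ (α.tsubst σ)) → ∀ α ∈ S, s.Bounds A γ (α.tsubst σ) := by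
  have single : ∀ α, CombClosure s X α → ∃ Y ⊆ X, Y.Finite ∧ ∀ (σ : ℕ → JTerm) (γ : JForm),
      (∀ α ∈ Y, s.Bounds A γ (α.tsubst σ)) → s.Bounds A γ (α.tsubst σ) := by
    intro α hα
    induction hα with
    | @base α h =>
      exact ⟨{α}, by simpa using h, Set.finite_singleton α, fun _ _ h => h α rfl⟩
    | comb _ _ ih₁ ih₂ =>
      obtain ⟨Y, hYX, hY, h⟩ := ih₁
      obtain ⟨Z, hZX, hZ, h'⟩ := ih₂
      refine ⟨Y ∪ Z, Set.union_subset hYX hZX, hY.union hZ, fun σ γ hγ => ?_⟩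
      have h₁ := h σ γ fun α hα => hγ α (Or.inl hα)
      have h₂ := h' σ γ fun α hα => hγ α (Or.inr hα)
      cases s with
      | T => exact hA.theory.and_intro h₁ h₂
      | F => exact hA.theory.or_elim h₁ h₂
  induction S, hS using Set.Finite.induction_on with
  | empty => exact fun _ => ⟨∅, Set.empty_subset _, Set.finite_empty, by simp⟩
  | @insert α S _ _ ih =>
    intro hS
    obtain ⟨Y, hYX, hY, h⟩ := ih fun β hβ => hS β (Or.inr hβ)
    obtain ⟨Z, hZX, hZ, h'⟩ := single α (hS α (Or.inl rfl))
    refine ⟨Y ∪ Z, Set.union_subset hYX hZX, hY.union hZ, fun σ γ hγ => ?_⟩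
    rintro β (rfl | hβ)
    · exact h' σ γ fun α hα => hγ α (Or.inr hα)
    · exact h σ γ (fun α hα => hγ α (Or.inl hα)) β hβ

/-- A combination is bounded once its finitely many components are, so only basic quasi-realizations
need conversion. -/
theorem JustSystem.convertible_of_basic {s : Pol} {φ : AnnForm}
    (h : ∀ Y ⊆ basicQuasi s φ, Y.Finite → Convertible A s φ Y) {S : Set JForm} (hS : S.Finite)
    (hSφ : S ⊆ quasi s φ) : Convertible A s φ S := by
  obtain ⟨Y, hYX, hY, hYS⟩ := hA.exists_finite_basis hS hSφ
  obtain ⟨σ, hσ, γ, hγ, hb⟩ := h Y hYX hY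
  exact ⟨σ, hσ, γ, hγ, hYS σ γ hb⟩

/-- Conversions for two formulas without common indices can be carried out simultaneously. -/
theorem JustSystem.convertible_pair {s s' : Pol} {φ ψ : AnnForm} {S S' : Set JForm}
    (hφ : Convertible A s φ S) (hψ : Convertible A s' ψ S')
    (hd : φ.modalities.Disjoint ψ.modalities) :
    ∃ ρ, LivesOn ρ (φ.modalities ++ ψ.modalities) ∧
      ∃ γ ∈ realizations s φ, ∃ δ ∈ realizations s' ψ,
        (∀ α ∈ S, s.Bounds A γ (α.tsubst ρ)) ∧ ∀ β ∈ S', s'.Bounds A δ (β.tsubst ρ) := by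
  obtain ⟨σ, hσ, γ, hγ, hS⟩ := hφ
  obtain ⟨τ, hτ, δ, hδ, hS'⟩ := hψ
  obtain ⟨ρ, hρ, h₁, h₂⟩ := hσ.merge hτ hd
  refine ⟨ρ, hρ, γ.tsubst τ, tsubst_mem_realizations φ (fun n hn => hτ.eq_var n (hd hn)) hγ,
    δ.tsubst σ, tsubst_mem_realizations ψ (fun n hn => hσ.eq_var n (hd.symm hn)) hδ,
    fun α hα => ?_, fun β hβ => ?_⟩
  · have := hA.bounds_tsubst τ (hS α hα)
    rwa [tsubst_tsubst, funext h₁] at this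
  · have := hA.bounds_tsubst σ (hS' β hβ)
    rwa [tsubst_tsubst, funext h₂] at this

/-- Finitely many formulas `t : α` with a common bound for the formulas `α` imply a single
formula `u : γ`. -/
theorem JustSystem.exists_common_term {S : Set JForm} (hS : S.Finite) {γ : JForm} {σ : ℕ → JTerm} :
    (∀ χ ∈ S, ∃ t α, χ = box t α ∧ (α.tsubst σ).imp γ ∈ justTheorems A) →
    ∃ u, ∀ χ ∈ S, (χ.tsubst σ).imp (box u γ) ∈ justTheorems A := by
  induction S, hS using Set.Finite.induction_on with
  | empty => exact fun _ => ⟨.const 0, by simp⟩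
  | @insert χ S _ _ ih =>
    intro h
    obtain ⟨u, hu⟩ := ih fun χ hχ => h χ (Or.inr hχ)
    obtain ⟨t, α, rfl, hα⟩ := h χ (Or.inl rfl)
    obtain ⟨v, -, hv⟩ := hA.internalize hα
    have hv' := hv .var
    have hid : ∀ ψ : JForm, ψ.tsubst .var = ψ := by
      have hid' : ∀ r : JTerm, r.subst .var = r := by
        intro r
        induction r <;> simp_all [JTerm.subst]
      intro ψ
      induction ψ <;> simp_all [Form.map]
    rw [hid] at hv'
    have hT := hA.theory
    -- The new term `v · t^σ` carries `t : α` to `γ`; the sum keeps what `u` already covers.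
    refine ⟨(v.app (t.subst σ)).sum u, ?_⟩
    rintro ψ (rfl | hψ)
    · exact hT.trans (hT.mp (mem_justTheorems (hA.application ⟨v, t.subst σ, _, _, rfl⟩)) hv')
        (mem_justTheorems (hA.sum ⟨_, _, _, Or.inl rfl⟩))
    · exact hT.trans (hu ψ hψ) (mem_justTheorems (hA.sum ⟨_, _, _, Or.inr rfl⟩))

/-- Finite sets rather than single formulas are converted, so that the induction can absorb the
combinations occurring at subformulas. -/
theorem JustSystem.convertible (φ : AnnForm) :
    φ.modalities.Nodup → ∀ (s : Pol) {S : Set JForm}, S.Finite → S ⊆ quasi s φ →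
      Convertible A s φ S := by
  have hT := hA.theory
  have livesOn_var : LivesOn JTerm.var [] := ⟨fun _ _ => rfl, fun _ _ h => h⟩
  induction φ with
  | bot =>
    intro _ s S hS hSq
    refine hA.convertible_of_basic (fun Y hY _ => ⟨_, livesOn_var, .bot, by simp [realizations],
      fun α hα => ?_⟩) hS hSq
    have : α = .bot := by simpa [basicQuasi] using hY hα
    subst this
    cases s <;> exact hT.refl _
  | var p =>
    intro _ s S hS hSq
    refine hA.convertible_of_basic (fun Y hY _ => ⟨_, livesOn_var, .var p, by simp [realizations],
      fun α hα => ?_⟩) hS hSq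
    have : α = .var p := by simpa [basicQuasi] using hY hα
    subst this
    cases s <;> exact hT.refl _
  | and φ ψ ih₁ ih₂ =>
    intro hnd s S hS hSq
    obtain ⟨hn₁, hn₂, hd⟩ := List.nodup_append'.1 hnd
    refine hA.convertible_of_basic (fun Y hY hYf => ?_) hS hSq
    simp only [basicQuasi] at hY
    obtain ⟨ρ, hρ, γ, hγ, δ, hδ, h₁, h₂⟩ := hA.convertible_pair
      (ih₁ hn₁ s (hYf.image Form.left) (by
        rintro _ ⟨χ, hχ, rfl⟩
        obtain ⟨α, β, hα, -, rfl⟩ := hY hχ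
        exact hα))
      (ih₂ hn₂ s (hYf.image Form.right) (by
        rintro _ ⟨χ, hχ, rfl⟩
        obtain ⟨α, β, -, hβ, rfl⟩ := hY hχ
        exact hβ)) hd
    refine ⟨ρ, hρ, _, ⟨γ, hγ, δ, hδ, rfl⟩, fun χ hχ => ?_⟩
    have hl := h₁ _ (Set.mem_image_of_mem _ hχ)
    have hr := h₂ _ (Set.mem_image_of_mem _ hχ)
    obtain ⟨α, β, -, -, rfl⟩ := hY hχ
    cases s <;> exact hT.and_mono hl hr
  | or φ ψ ih₁ ih₂ =>
    intro hnd s S hS hSq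
    obtain ⟨hn₁, hn₂, hd⟩ := List.nodup_append'.1 hnd
    refine hA.convertible_of_basic (fun Y hY hYf => ?_) hS hSq
    simp only [basicQuasi] at hY
    obtain ⟨ρ, hρ, γ, hγ, δ, hδ, h₁, h₂⟩ := hA.convertible_pair
      (ih₁ hn₁ s (hYf.image Form.left) (by
        rintro _ ⟨χ, hχ, rfl⟩
        obtain ⟨α, β, hα, -, rfl⟩ := hY hχ
        exact hα))
      (ih₂ hn₂ s (hYf.image Form.right) (by
        rintro _ ⟨χ, hχ, rfl⟩
        obtain ⟨α, β, -, hβ, rfl⟩ := hY hχ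
        exact hβ)) hd
    refine ⟨ρ, hρ, _, ⟨γ, hγ, δ, hδ, rfl⟩, fun χ hχ => ?_⟩
    have hl := h₁ _ (Set.mem_image_of_mem _ hχ)
    have hr := h₂ _ (Set.mem_image_of_mem _ hχ)
    obtain ⟨α, β, -, -, rfl⟩ := hY hχ
    cases s <;> exact hT.or_mono hl hr
  | imp φ ψ ih₁ ih₂ =>
    intro hnd s S hS hSq
    obtain ⟨hn₁, hn₂, hd⟩ := List.nodup_append'.1 hnd
    refine hA.convertible_of_basic (fun Y hY hYf => ?_) hS hSq
    simp only [basicQuasi] at hY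
    obtain ⟨ρ, hρ, γ, hγ, δ, hδ, h₁, h₂⟩ := hA.convertible_pair
      (ih₁ hn₁ s.flip (hYf.image Form.left) (by
        rintro _ ⟨χ, hχ, rfl⟩
        obtain ⟨α, β, hα, -, rfl⟩ := hY hχ
        exact hα))
      (ih₂ hn₂ s (hYf.image Form.right) (by
        rintro _ ⟨χ, hχ, rfl⟩
        obtain ⟨α, β, -, hβ, rfl⟩ := hY hχ
        exact hβ)) hd
    refine ⟨ρ, hρ, _, ⟨γ, hγ, δ, hδ, rfl⟩, fun χ hχ => ?_⟩
    have hl := h₁ _ (Set.mem_image_of_mem _ hχ)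
    have hr := h₂ _ (Set.mem_image_of_mem _ hχ)
    obtain ⟨α, β, -, -, rfl⟩ := hY hχ
    cases s <;> exact hT.imp_mono hl hr
  | box n φ ih =>
    intro hnd s S hS hSq
    obtain ⟨hn, hnd⟩ := List.nodup_cons.1 hnd
    refine hA.convertible_of_basic (fun Y hY hYf => ?_) hS hSq
    cases s with
    | T =>
      simp only [basicQuasi] at hY
      obtain ⟨σ, hσ, γ, hγ, hb⟩ := ih hnd .T (hYf.image Form.right) (by
        rintro _ ⟨χ, hχ, rfl⟩
        obtain ⟨α, hα, rfl⟩ := hY hχ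
        exact hα)
      -- One closed `u` must serve all the implications `γ → α^σ`, because `x_n` can receive only
      -- one value.
      obtain ⟨u, hu, hu'⟩ := hA.internalize_finite
        (hYf.image fun χ => γ.imp (χ.right.tsubst σ)) (by
          rintro _ ⟨χ, hχ, rfl⟩
          exact hb _ (Set.mem_image_of_mem _ hχ))
      -- With `x_n ↦ u · x_n`, the application axiom gives `x_n : γ^τ → (u · x_n) : α^ρ`. Since `n`
      -- does not index a box of `φ`, `γ^τ` is still a realization.
      have hτ : LivesOn (fun m => if m = n then u.app (.var n) else .var m) [n] := by
        refine ⟨fun m hm => if_neg (by simpa using hm), fun m ρ hρ => ?_⟩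
        split_ifs with h
        · subst h
          simp only [JTerm.subst, hu, hρ]
        · exact hρ
      obtain ⟨ρ, hρ, h₁, -⟩ := hσ.merge hτ (by simpa using hn)
      refine ⟨ρ, ⟨fun m hm => hρ.eq_var m fun h => hm ?_, hρ.no_new⟩, _,
        ⟨_, tsubst_mem_realizations φ (fun m hm => hτ.eq_var m ?_) hγ, rfl⟩, fun χ hχ => ?_⟩
      · simpa [modalities, or_comm] using h
      · rintro h
        exact hn (List.mem_singleton.1 h ▸ hm)
      · have hmem := hu' _ (Set.mem_image_of_mem _ hχ)
          (fun m => if m = n then u.app (.var n) else .var m)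
        obtain ⟨α, -, rfl⟩ := hY hχ
        have hρn : ρ n = u.app (.var n) := by
          rw [← h₁, hσ.eq_var n hn]
          exact if_pos rfl
        simp only [Form.map, Form.right, tsubst_tsubst, funext h₁] at hmem
        simp only [Pol.Bounds, Form.map, JTerm.subst, hρn]
        exact hT.mp (mem_justTheorems (hA.application ⟨_, _, _, _, rfl⟩)) hmem
    | F =>
      simp only [basicQuasi] at hY
      obtain ⟨σ, hσ, γ, hγ, hb⟩ := ih hnd .F (hYf.image Form.right) (by
        rintro _ ⟨χ, hχ, rfl⟩
        obtain ⟨α, t, hα, rfl⟩ := hY hχ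
        exact hα)
      obtain ⟨u, hu⟩ := hA.exists_common_term (γ := γ) (σ := σ) hYf (by
        intro χ hχ
        have h := hb _ (Set.mem_image_of_mem _ hχ)
        obtain ⟨α, t, -, rfl⟩ := hY hχ
        exact ⟨t, α, rfl, h⟩)
      exact ⟨σ, ⟨fun m hm => hσ.eq_var m fun h => hm (List.mem_cons_of_mem _ h), hσ.no_new⟩,
        box u γ, ⟨γ, hγ, u, rfl⟩, hu⟩

end Conversion

/-! ### Realization -/

/-- The annotation of the boxes of a formula by consecutive numbers from `k` on. -/
theorem exists_annotation (φ : ModalForm) : ∀ k : ℕ, ∃ φ' : AnnForm, ∃ m,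
    φ'.map (fun _ => ()) = φ ∧ φ'.modalities.Nodup ∧ k ≤ m ∧
      ∀ n ∈ φ'.modalities, k ≤ n ∧ n < m := by
  -- Subformulas take their indices from adjacent intervals `[k, m)` and `[m, m')`, hence disjoint
  -- ones.
  have append : ∀ {l l' : List ℕ} {k m m' : ℕ}, l.Nodup → l'.Nodup →
      (∀ n ∈ l, k ≤ n ∧ n < m) → (∀ n ∈ l', m ≤ n ∧ n < m') → k ≤ m → m ≤ m' →
      (l ++ l').Nodup ∧ k ≤ m' ∧ ∀ n ∈ l ++ l', k ≤ n ∧ n < m' := by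
    intro l l' k m m' hl hl' h h' hk hm
    refine ⟨List.nodup_append'.2 ⟨hl, hl', fun n hn hn' => ?_⟩, by omega, fun n hn => ?_⟩
    · have := h n hn
      have := h' n hn'
      omega
    · rcases List.mem_append.1 hn with hn | hn
      · have := h n hn
        omega
      · have := h' n hn
        omega
  induction φ with
  | bot => exact fun k => ⟨.bot, k, rfl, by simp [modalities]⟩
  | var p => exact fun k => ⟨.var p, k, rfl, by simp [modalities]⟩
  | and φ ψ ih₁ ih₂ =>
    intro k
    obtain ⟨φ', m, rfl, hn, hk, h⟩ := ih₁ k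
    obtain ⟨ψ', m', rfl, hn', hk', h'⟩ := ih₂ m
    exact ⟨.and φ' ψ', m', rfl, append hn hn' h h' hk hk'⟩
  | or φ ψ ih₁ ih₂ =>
    intro k
    obtain ⟨φ', m, rfl, hn, hk, h⟩ := ih₁ k
    obtain ⟨ψ', m', rfl, hn', hk', h'⟩ := ih₂ m
    exact ⟨.or φ' ψ', m', rfl, append hn hn' h h' hk hk'⟩
  | imp φ ψ ih₁ ih₂ =>
    intro k
    obtain ⟨φ', m, rfl, hn, hk, h⟩ := ih₁ k
    obtain ⟨ψ', m', rfl, hn', hk', h'⟩ := ih₂ m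
    exact ⟨.imp φ' ψ', m', rfl, append hn hn' h h' hk hk'⟩
  | box u φ ih =>
    intro k
    obtain ⟨φ', m, rfl, hn, hk, h⟩ := ih (k + 1)
    exact ⟨.box k φ', m, rfl, append (l := [k]) (m := k + 1) (List.nodup_singleton k) hn
      (by simp) h (by omega) hk⟩

/-- A justification logic realizes every set of modal formulas valid in its canonical frame. -/
theorem JustSystem.realizes {A : Set JForm} (hA : JustSystem A) {S : Set ModalForm}
    (hS : ∀ φ ∈ S, FrameValid (World.Rel (A := A)) φ) : Realizes (justLogic A) S := by
  intro φ hφ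
  have main : ∀ φ' : AnnForm, IsUniqueAnnotation φ φ' →
      ∃ ψ ∈ justLogic A, ψ ∈ realizations Pol.F φ' := by
    rintro φ' ⟨rfl, hnd⟩
    obtain ⟨α, hα, hαA⟩ := exists_quasi_mem hA (hS _ hφ)
    obtain ⟨σ, -, γ, hγ, h⟩ := hA.convertible φ' hnd .F (Set.finite_singleton α)
      (Set.singleton_subset_iff.2 hα)
    exact ⟨γ, hA.justTheorems_subset (hA.theory.mp (h α rfl) (hA.tsubst_mem σ hαA)), hγ⟩
  obtain ⟨φ', m, h, hnd, -⟩ := exists_annotation φ 0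
  obtain ⟨ψ, hψ, hψ'⟩ := main φ' ⟨h, hnd⟩
  exact ⟨⟨ψ, hψ, φ', ⟨h, hnd⟩, hψ'⟩, main⟩

/-- The four justification logics over `L` realize the corresponding modal logics if `L` is valid
in their canonical frames. -/
theorem realizes_of_canonical {L : Set PropForm} (hIPC : IPC ⊆ L)
    (hL : ∀ A : Set JForm, substClosure L ⊆ A →
      ∀ φ ∈ L, FrameValid (World.Rel (A := A)) (ofProp Unit φ)) :
    Realizes (justJ L) (modalK L) ∧ Realizes (justJT L) (modalT L) ∧
      Realizes (justJ4 L) (modalK4 L) ∧ Realizes (justJT4 L) (modalS4 L) := by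
  have hJ : JustSystem (substClosure L ∪ AxJ ∪ AxSum) :=
    ⟨(intSystem_substClosure hIPC).mono fun _ h => Or.inl (Or.inl h),
      fun _ h => Or.inl (Or.inr h), fun _ h => Or.inr h,
      ((tsubstClosed_substClosure L).union tsubstClosed_AxJ).union tsubstClosed_AxSum⟩
  have extend : ∀ {A B : Set JForm}, JustSystem A → TSubstClosed B → JustSystem (A ∪ B) :=
    fun hA hB => ⟨hA.toIntSystem.mono Set.subset_union_left,
      hA.application.trans Set.subset_union_left, hA.sum.trans Set.subset_union_left,
      hA.tsubst.union hB⟩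
  have hK : ∀ A : Set JForm, substClosure L ⊆ A →
      ∀ φ ∈ modalK L, FrameValid (World.Rel (A := A)) φ :=
    fun A hA => frameValid_modalK World.rel_of_le (hL A hA)
  refine ⟨hJ.realizes (hK _ ?_), (extend hJ tsubstClosed_AxF).realizes ?_,
    (extend hJ tsubstClosed_AxI).realizes ?_,
    (extend (extend hJ tsubstClosed_AxF) tsubstClosed_AxI).realizes ?_⟩
  · exact fun _ h => Or.inl (Or.inl h)
  · exact frameValid_oplus World.rel_of_le (hK _ fun _ h => Or.inl (Or.inl (Or.inl h)))
      (frameValid_AxT (World.rel_refl fun _ h => Or.inr h))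
  · exact frameValid_oplus World.rel_of_le (hK _ fun _ h => Or.inl (Or.inl (Or.inl h)))
      (frameValid_Ax4 (World.rel_trans fun _ h => Or.inr h))
  · exact frameValid_oplus World.rel_of_le
      (frameValid_oplus World.rel_of_le
        (hK _ fun _ h => Or.inl (Or.inl (Or.inl (Or.inl h))))
        (frameValid_AxT (World.rel_refl fun _ h => Or.inl (Or.inr h))))
      (frameValid_Ax4 (World.rel_trans fun _ h => Or.inr h))

end InterJust

/-- What remains is canonicity of the propositional logics. The scheme `BC (n - 1)` excludes strict
chains of `n` worlds above a common world. -/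
theorem mainTheorem12 :
    (∀ n : ℕ, 2 ≤ n →
      Realizes (justJ (Gn n)) (modalK (Gn n)) ∧
      Realizes (justJT (Gn n)) (modalT (Gn n)) ∧
      Realizes (justJ4 (Gn n)) (modalK4 (Gn n)) ∧
      Realizes (justJT4 (Gn n)) (modalS4 (Gn n))) ∧
    (Realizes (justJ KC) (modalK KC) ∧
      Realizes (justJT KC) (modalT KC) ∧
      Realizes (justJ4 KC) (modalK4 KC) ∧
      Realizes (justJT4 KC) (modalS4 KC)) := by
  refine ⟨fun n _ => realizes_of_canonical (fun φ h => .base (Or.inl (.base (Or.inl h))))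
    fun A hA => ?_, realizes_of_canonical (fun φ h => .base (Or.inl h)) fun A hA => ?_⟩
  · have hlin := World.linear (A := A) (L := Gn n)
      (fun φ h => .base (Or.inl (.base (Or.inr h)))) hA
    exact frameValid_plus
      (frameValid_plus (frameValid_IPC World.rel_of_le) (frameValid_LIN World.rel_of_le hlin))
      (frameValid_BC World.rel_of_le hlin
        (World.no_chain (L := Gn n) (fun φ h => .base (Or.inr h)) hA))
  · exact frameValid_plus (frameValid_IPC World.rel_of_le)
      (frameValid_WLEM World.rel_of_le
        (World.directed (L := KC) (fun φ h => .base (Or.inr h)) hA))
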